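/- **System.** A base station with $L\ge 2$ antennas and a library of $N\ge K_1+K_2$ files of $F$ bits serves $K_1\ge1$ users with caches of normalized size $\gamma_1$ (a user stores at most $\gamma_1NF$ bits) and $K_2\ge1$ users with caches of normalized size $\gamma_2$, where $0<\gamma_2<\gamma_1<1$ and $K_1\gamma_1,K_2\gamma_2$ are integers. In each channel use the base station sends $\mathbf x\in\mathbb C^L$ with $\mathbb E\|\mathbf x\|^2\le P$, and user $k$ receives $y_k=\mathbf h_k^H\mathbf x+w_k$ with i.i.d. noise $w_k\sim\mathcal{CN}(0,1)$. The channel vectors $\mathbf h_k\in\mathbb C^L$ are constant, known to everybody, and such that any at most $L$ of them are linearly independent. The caches are filled before the channel, the power and the demands are known; then every user asks for one file, all demands being distinct. A delay $T$ is *achievable* if there is a placement (one for each $F$) such that for every such channel, every $\varepsilon>0$ and every sufficiently large $P$, and for every $\delta>0$, there are arbitrarily large $F$ for which every vector of distinct demands can be served, with error probability at most $\delta$ for every content of the library, in $n\le (T+\varepsilon)F/\log_2P$ channel uses. (Thus one unit of time is what an interference-free link needs, to first order in $\log P$, to deliver one file.) **Theorem 4.** Let $T_{K_1}=\dfrac{K_1(1-\gamma_1)}{1+K_1\gamma_1}$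 and $$T=\begin{cases}\dfrac{K_1(1-\gamma_1)+K_2(1-\gamma_2)}{L+K_1\gamma_1+K_2\gamma_2}&\text{if } T_{K_1}\ge\dfrac{K_2(1-\gamma_2)}{L-1+K_2\gamma_2},\\[3mm] T_{K_1}+\dfrac{K_2(1-\gamma_2)-(L-1+K_2\gamma_2)T_{K_1}}{\min\{K_2,\;L+K_2\gamma_2\}}&\text{otherwise.}\end{cases}$$ In the first case, $T=\dfrac{K(1-\gamma)}{L+K\gamma}$ with $K=K_1+K_2$ and $\gamma=\dfrac{K_1\gamma_1+K_2\gamma_2}{K}$, which is the delay of the homogeneous system with $K$ users and the same total cache. In both cases, if $T\ge 1-\gamma_2$ (no smaller delay is possible for a user with a cache of size $\gamma_2$), then the delay $T$ is achievable. -/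

import Mathlib

open MeasureTheory ProbabilityTheory Filter

namespace MisoBC

/-- A file of `F` bits. -/
abbrev File (F : ℕ) : Type := Fin F → Bool

/-- A library of `N` files of `F` bits each. -/
abbrev Library (N F : ℕ) : Type := Fin N → File F

/-- The law `ℂ𝒩(0,1)`: independent real and imaginary parts, each centred Gaussian of
variance `1/2`. -/
noncomputable def complexNoise : Measure ℂ :=
  ((gaussianReal 0 (1 / 2)).prod (gaussianReal 0 (1 / 2))).map
    (fun p : ℝ × ℝ => Complex.equivRealProdCLM.symm p)

instance : IsProbabilityMeasure complexNoise :=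
  Measure.isProbabilityMeasure_map
    Complex.equivRealProdCLM.symm.continuous.measurable.aemeasurable

/-- The noise seen by all users during `n` channel uses, i.i.d. `ℂ𝒩(0,1)`. -/
noncomputable def noiseLaw (U : Type) [Fintype U] (n : ℕ) : Measure (U → Fin n → ℂ) :=
  Measure.pi fun _ => Measure.pi fun _ => complexNoise

/-- Pre-fetching: user `k` stores `size k` bits, an arbitrary function of the library. -/
structure Placement (U : Type) (N F : ℕ) where
  size : U → ℕ
  store : (k : U) → Library N F → Fin (size k) → Bool

/-- The cache of user `k` holds at most the fraction `γ k` of the `N * F` bits of the library. -/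
def Placement.Fits {U : Type} {N F : ℕ} (Z : Placement U N F) (γ : U → ℝ) : Prop :=
  ∀ k, (Z.size k : ℝ) ≤ γ k * (N * F)

/-- Delivery in `n` uses of a channel with `L` transmit antennas: the vectors sent by the base
station as a function of the library, and the decoder of each user, which sees the user's cache
and the `n` received symbols. -/
structure Delivery {U : Type} {N F : ℕ} (Z : Placement U N F) (L n : ℕ) where
  encode : Library N F → Fin n → EuclideanSpace ℂ (Fin L)
  decode : (k : U) → (Fin (Z.size k) → Bool) → (Fin n → ℂ) → File F
  measurable_decode : ∀ k z, Measurable (decode k z)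

namespace Delivery

variable {U : Type} {N F L n : ℕ} {Z : Placement U N F}

/-- The received signal `y_k = h_kᴴ x + w_k` of user `k` (one value for each channel use). -/
noncomputable def received (D : Delivery Z L n) (h : U → EuclideanSpace ℂ (Fin L))
    (W : Library N F) (w : U → Fin n → ℂ) (k : U) : Fin n → ℂ :=
  fun i => inner ℂ (h k) (D.encode W i) + w k i

/-- The power constraint `𝔼 ‖x‖² ≤ P` in every channel use, for uniformly distributed files. -/
def PowerAtMost (D : Delivery Z L n) (P : ℝ) : Prop :=
  ∀ i, (∑ W : Library N F, ‖D.encode W i‖ ^ 2) / (Fintype.card (Library N F) : ℝ) ≤ P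

/-- Under demand `d`, and whatever the content of the library, all users recover their files
simultaneously, except with probability at most `δ` over the noise. -/
def ErrorAtMost [Fintype U] (D : Delivery Z L n) (h : U → EuclideanSpace ℂ (Fin L))
    (d : U → Fin N) (δ : ℝ) : Prop :=
  ∀ W : Library N F,
    noiseLaw U n {w | ∃ k, D.decode k (Z.store k W) (D.received h W w k) ≠ W (d k)}
      ≤ ENNReal.ofReal δ

end Delivery

/-- Channel vectors in general position: any at most `L` of them are linearly independent. -/
def GeneralPosition {U : Type} {L : ℕ} (h : U → EuclideanSpace ℂ (Fin L)) : Prop :=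
  ∀ s : Finset U, s.card ≤ L → LinearIndependent ℂ (fun k : s => h k)

/-- `T` is an achievable (normalized, worst-case) delay for the users `U` with cache fractions `γ`,
`L` transmit antennas and a library of `N` files.

The placement knows neither the channel, nor the power, nor the demands. For every
channel in general position and every `ε > 0`, at every sufficiently large power `P`, there are
arbitrarily long files for which any distinct demands are served with arbitrarily small
error probability in a number `n` of channel uses which, in units of the `F / log₂ P` channel uses
that an interference-free link needs for one file, is at most `T + ε`. -/
def AchievableDelay {U : Type} [Fintype U] (γ : U → ℝ) (L N : ℕ) (T : ℝ) : Prop :=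
  ∃ Z : (F : ℕ) → Placement U N F, (∀ F, (Z F).Fits γ) ∧
    ∀ h : U → EuclideanSpace ℂ (Fin L), GeneralPosition h →
      ∀ ε : ℝ, 0 < ε → ∀ᶠ P : ℝ in atTop,
        ∀ δ : ℝ, 0 < δ → ∃ᶠ F : ℕ in atTop,
          ∀ d : U → Fin N, Function.Injective d →
            ∃ n : ℕ, n * Real.logb 2 P ≤ (T + ε) * F ∧
              ∃ D : Delivery (Z F) L n, D.PowerAtMost P ∧ D.ErrorAtMost h d δ

/-- The single-antenna delay `K(1-γ)/(1+Kγ)` of `K` users with cache fraction `γ`. -/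
noncomputable def singleDelay (K : ℕ) (γ : ℝ) : ℝ := K * (1 - γ) / (1 + K * γ)

/-- The delay `K(1-γ)/(L+Kγ)` of the homogeneous `L`-antenna system. -/
noncomputable def homogeneousDelay (L K : ℕ) (γ : ℝ) : ℝ := K * (1 - γ) / (L + K * γ)

/-- The delay of the two-type system when the full gain `L + K₁γ₁ + K₂γ₂` is available. -/
noncomputable def fullGainDelay (L K₁ : ℕ) (γ₁ : ℝ) (K₂ : ℕ) (γ₂ : ℝ) : ℝ :=
  (K₁ * (1 - γ₁) + K₂ * (1 - γ₂)) / (L + K₁ * γ₁ + K₂ * γ₂)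

/-- The delay of the two-type system in the remaining case. -/
noncomputable def twoPhaseDelay (L K₁ : ℕ) (γ₁ : ℝ) (K₂ : ℕ) (γ₂ : ℝ) : ℝ :=
  singleDelay K₁ γ₁ +
    (K₂ * (1 - γ₂) - (L - 1 + K₂ * γ₂) * singleDelay K₁ γ₁) / min (K₂ : ℝ) (L + K₂ * γ₂)

/-- `K₁` users with cache fraction `γ₁` and `K₂` users with cache fraction `γ₂`. -/
def twoTypes (K₁ : ℕ) (γ₁ : ℝ) (K₂ : ℕ) (γ₂ : ℝ) : Fin K₁ ⊕ Fin K₂ → ℝ :=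
  Sum.elim (fun _ => γ₁) (fun _ => γ₂)

end MisoBC

namespace MisoBC

/-! Delivery reduces to combinatorics. In a slot the base station superposes one coded piece per
served user, each along a beamformer nulled at fewer than `L` users; a user that caches an
interfering piece cancels it. So a slot works as soon as each of its pieces is cached by all but at
most `L - 1` of the other served users. `HasScheme.achievableDelay` turns such a scheme, with `R`
slots for `D` pieces, into the delay `R / D`: Gilbert–Varshamov codes over a grid constellation
carry almost `log₂ P` bits per channel use.

Schemes come from counting. By `hasScheme_of_orbit` it suffices to match, injectively, the pairs
(user, lacked piece class) with the pairs (place, slot class); the orbit under permutations of the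
users does the rest. `exists_hasScheme_twoTypes` then asks only for enough places for each type and
for few enough unprotected users.

Write `Kᵢ = tᵢ + rᵢ` with `tᵢ = Kᵢγᵢ`, `L = l + 1`, `u = L + t₁ + t₂`, `v = r₁ + r₂`. Full gain
means `v` slots of `u` users for `u` pieces, with `r₁ * u / v` users of the first type per slot on
average. Pieces cached by `t₁` and `t₂` users allow slots with `a` users of the first type when `t₁
< a ≤ t₁ + l`. The lower bound on the average is the condition of the first case, and `T ≥ 1 - γ₂`
says that the second type has enough users. If the average exceeds `t₁ + l`, some pieces are cached
by `t₁ + 1` and `t₂ - 1` users instead, and memory sharing with the homogeneous scheme, which has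
the same delay, repairs the cache sizes. In the second case, slots with `t₁ + 1` and `l + t₂` users
exhaust the first type, and the remaining ones serve `min {K₂, L + t₂}` users of the second. -/

/-- A linear one-shot delivery scheme with uncoded placement. Every file is cut into `D` pieces,
user `k` caches the same `c k` pieces of every file, and the pieces it lacks are sent to it in
different ones of the `R` slots. A piece is a nuisance to fewer than `L` other users of its slot. -/
def HasScheme (U : Type) (L D R : ℕ) (c : U → ℕ) : Prop :=
  ∃ (Q S : Type) (_ : Fintype Q) (_ : Fintype S) (C : U → Finset Q) (served : S → Set U)
    (slot : U → Q → S),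
    Fintype.card Q = D ∧ Fintype.card S = R ∧ (∀ k, (C k).card = c k) ∧
    (∀ k q, q ∉ C k → k ∈ served (slot k q)) ∧
    (∀ k q q', q ∉ C k → q' ∉ C k → slot k q = slot k q' → q = q') ∧
    (∀ k q, q ∉ C k → ∃ J : Finset U, k ∉ J ∧ J.card < L ∧
      ∀ j ∈ served (slot k q), j ≠ k → q ∈ C j ∨ j ∈ J)

/-! ### Codes with large Hamming distance and the grid constellation. -/

section Coding

/-- Crude on purpose: at most `2 ^ n` sets of disagreement, and at most `|Q| ^ d` patterns on each.
The factor `2 ^ n` costs one bit per symbol, negligible for a growing alphabet. -/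
lemma card_hammingBall_le {Q : Type} [Fintype Q] [DecidableEq Q] [Nonempty Q] {n : ℕ} (d : ℕ)
    (x : Fin n → Q) :
    (Finset.univ.filter fun y : Fin n → Q => hammingDist x y < d).card
      ≤ 2 ^ n * Fintype.card Q ^ d := by
  classical
  have hsub : (Finset.univ.filter fun y : Fin n → Q => hammingDist x y < d) ⊆
      ((Finset.univ : Finset (Finset (Fin n))).filter (fun s => s.card < d)).biUnion
        (fun s => Finset.univ.filter fun y : Fin n → Q => ∀ i, i ∉ s → y i = x i) := by
    intro y hy
    simp only [Finset.mem_filter, Finset.mem_univ, true_and, Finset.mem_biUnion] at hy ⊢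
    refine ⟨Finset.univ.filter fun i => x i ≠ y i, hy, fun i hi => ?_⟩
    simpa [eq_comm] using hi
  have hone : ∀ s : Finset (Fin n), s.card < d →
      (Finset.univ.filter fun y : Fin n → Q => ∀ i, i ∉ s → y i = x i).card
        ≤ Fintype.card Q ^ d := by
    intro s hs
    have h1 : (Finset.univ.filter fun y : Fin n → Q => ∀ i, i ∉ s → y i = x i).card
        ≤ Fintype.card (s → Q) := by
      rw [← Finset.card_univ]
      refine Finset.card_le_card_of_injOn (fun y i => y i) (fun _ _ => Finset.mem_univ _) ?_
      intro y hy z hz hyz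
      simp only [Finset.coe_filter, Finset.mem_univ, true_and, Set.mem_ofPred_eq] at hy hz
      funext i
      by_cases hi : i ∈ s
      · exact congrFun hyz ⟨i, hi⟩
      · rw [hy i hi, hz i hi]
    refine h1.trans ?_
    rw [Fintype.card_fun, Fintype.card_coe]
    exact Nat.pow_le_pow_right Fintype.card_pos hs.le
  refine (Finset.card_le_card hsub).trans (Finset.card_biUnion_le.trans ?_)
  calc _ ≤ ∑ s ∈ (Finset.univ : Finset (Finset (Fin n))).filter (fun s => s.card < d),
          Fintype.card Q ^ d :=
        Finset.sum_le_sum fun s hs => hone s (by simpa using hs)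
    _ ≤ ∑ s : Finset (Fin n), Fintype.card Q ^ d :=
        Finset.sum_le_sum_of_subset (Finset.filter_subset _ _)
    _ = 2 ^ n * Fintype.card Q ^ d := by simp

/-- The Gilbert–Varshamov bound. -/
lemma exists_code {Q : Type} [Fintype Q] [DecidableEq Q] [Nonempty Q] {n d f : ℕ} (hd : 0 < d)
    (h : 2 ^ f * (2 ^ n * Fintype.card Q ^ d) ≤ Fintype.card Q ^ n) :
    ∃ enc : (Fin f → Bool) → Fin n → Q, ∀ m m', m ≠ m' → d ≤ hammingDist (enc m) (enc m') := by
  classical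
  obtain ⟨C, hC, hmax⟩ := Finset.exists_max_image
    ((Finset.univ : Finset (Finset (Fin n → Q))).filter
      (fun C => ∀ x ∈ C, ∀ y ∈ C, x ≠ y → d ≤ hammingDist x y)) Finset.card
    ⟨∅, by simp⟩
  simp only [Finset.mem_filter, Finset.mem_univ, true_and] at hC hmax
  -- A code of maximal size is covering: a word outside all balls could be added to it.
  have hcover : (Finset.univ : Finset (Fin n → Q)) ⊆
      C.biUnion (fun x => Finset.univ.filter fun y => hammingDist x y < d) := by
    intro y _
    by_contra hy
    simp only [Finset.mem_biUnion, Finset.mem_filter, Finset.mem_univ, true_and, not_exists,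
      not_and, not_lt] at hy
    have hyC : y ∉ C := fun hyC => by
      have := hy y hyC
      rw [hammingDist_self] at this
      omega
    have := hmax (insert y C) (by
      intro a ha b hb hab
      rcases Finset.mem_insert.1 ha with rfl | ha' <;> rcases Finset.mem_insert.1 hb with rfl | hb'
      · exact absurd rfl hab
      · rw [hammingDist_comm]; exact hy b hb'
      · exact hy a ha'
      · exact hC a ha' b hb' hab)
    rw [Finset.card_insert_of_notMem hyC] at this
    omega
  have hcard : Fintype.card Q ^ n ≤ C.card * (2 ^ n * Fintype.card Q ^ d) := by
    calc Fintype.card Q ^ n = (Finset.univ : Finset (Fin n → Q)).card := by simp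
      _ ≤ _ := Finset.card_le_card hcover
      _ ≤ ∑ x ∈ C, _ := Finset.card_biUnion_le
      _ ≤ ∑ x ∈ C, (2 ^ n * Fintype.card Q ^ d) :=
        Finset.sum_le_sum fun x _ => card_hammingBall_le d x
      _ = _ := by simp
  have hle : 2 ^ f ≤ C.card := by
    refine Nat.le_of_mul_le_mul_right (h.trans hcard) ?_
    have : 0 < Fintype.card Q := Fintype.card_pos
    positivity
  obtain ⟨φ⟩ : Nonempty ((Fin f → Bool) ↪ C) :=
    Function.Embedding.nonempty_of_card_le (by simpa using hle)
  refine ⟨fun m => (φ m : Fin n → Q), fun m m' hmm => hC _ (φ m).2 _ (φ m').2 fun h => hmm ?_⟩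
  exact φ.injective (Subtype.ext h)

/-- A square grid of `m ^ 2` points in the complex plane with spacing `s`. -/
noncomputable def gridPoint (s : ℝ) {m : ℕ} (a : Fin m × Fin m) : ℂ :=
  (s : ℂ) * ((a.1 : ℕ) + (a.2 : ℕ) * Complex.I)

lemma norm_gridPoint_le {s : ℝ} (hs : 0 ≤ s) {m : ℕ} (a : Fin m × Fin m) :
    ‖gridPoint s a‖ ≤ 2 * s * m := by
  have h1 : ‖((a.1 : ℕ) : ℂ) + ((a.2 : ℕ) : ℂ) * Complex.I‖ ≤ m + m := by
    refine (norm_add_le _ _).trans (add_le_add ?_ ?_)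
    · rw [Complex.norm_natCast]; exact_mod_cast a.1.2.le
    · rw [norm_mul, Complex.norm_I, mul_one, Complex.norm_natCast]; exact_mod_cast a.2.2.le
  rw [gridPoint, norm_mul, Complex.norm_real, Real.norm_of_nonneg hs]
  nlinarith

lemma le_norm_gridPoint_sub {s : ℝ} (hs : 0 ≤ s) {m : ℕ} {a b : Fin m × Fin m} (hab : a ≠ b) :
    s ≤ ‖gridPoint s a - gridPoint s b‖ := by
  have habs : ∀ x y : Fin m, x ≠ y → (1 : ℝ) ≤ |((x : ℕ) : ℝ) - ((y : ℕ) : ℝ)| := by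
    intro x y hxy
    have h : ((x : ℕ) : ℤ) - ((y : ℕ) : ℤ) ≠ 0 := by
      intro h; exact hxy (Fin.ext (by omega))
    exact_mod_cast Int.one_le_abs h
  rw [gridPoint, gridPoint, ← mul_sub, norm_mul, Complex.norm_real, Real.norm_of_nonneg hs]
  refine le_mul_of_one_le_right hs ?_
  by_cases h1 : a.1 = b.1
  · have h2 : a.2 ≠ b.2 := fun h2 => hab (Prod.ext h1 h2)
    refine (habs _ _ h2).trans ?_
    refine le_trans (le_of_eq ?_) (Complex.abs_im_le_norm _)
    simp
  · refine (habs _ _ h1).trans ?_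
    refine le_trans (le_of_eq ?_) (Complex.abs_re_le_norm _)
    simp

end Coding

/-! ### Tail bounds for the noise. -/

section Noise

lemma noiseLaw_forall_mem {U : Type} [Fintype U] {n : ℕ} (k : U) (J : Finset (Fin n))
    (A : Set ℂ) :
    noiseLaw U n {w | ∀ j ∈ J, w k j ∈ A} = complexNoise A ^ J.card := by
  classical
  have hset : {w : U → Fin n → ℂ | ∀ j ∈ J, w k j ∈ A} =
      Set.pi Set.univ (fun k' => Set.pi Set.univ
        (fun j => if k' = k ∧ j ∈ J then A else Set.univ)) := by
    ext w
    simp only [Set.mem_ofPred_eq, Set.mem_pi, Set.mem_univ, true_imp_iff]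
    constructor
    · intro h k' j
      split_ifs with hc
      · rw [hc.1]; exact h j hc.2
      · trivial
    · intro h j hj
      have := h k j
      rwa [if_pos ⟨rfl, hj⟩] at this
  rw [hset, noiseLaw, Measure.pi_pi]
  simp only [Measure.pi_pi]
  rw [Finset.prod_eq_single k]
  · rw [Finset.prod_congr rfl (g := fun j => if j ∈ J then complexNoise A else 1)]
    · rw [Finset.prod_ite_mem]; simp
    · intro j _
      by_cases hj : j ∈ J <;> simp [hj]
  · intro k' _ hk'
    simp [hk']
  · simp

/-- Union bound over the sets of `M` positions. The number of these sets is later beaten by a small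
enough tail probability. -/
lemma noiseLaw_le_card_filter_le {U : Type} [Fintype U] {n : ℕ} (k : U) (I : Finset (Fin n))
    (A : Set ℂ) [DecidablePred (· ∈ A)] (M : ℕ) :
    noiseLaw U n {w | M ≤ (I.filter fun j => w k j ∈ A).card}
      ≤ 2 ^ I.card * complexNoise A ^ M := by
  have hsub : {w : U → Fin n → ℂ | M ≤ (I.filter fun j => w k j ∈ A).card} ⊆
      ⋃ J ∈ I.powersetCard M, {w | ∀ j ∈ J, w k j ∈ A} := by
    intro w hw
    obtain ⟨J, hJ, hcard⟩ := Finset.exists_subset_card_eq hw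
    simp only [Set.mem_iUnion]
    refine ⟨J, Finset.mem_powersetCard.2 ⟨hJ.trans (Finset.filter_subset _ _), hcard⟩, ?_⟩
    intro j hj
    exact (Finset.mem_filter.1 (hJ hj)).2
  refine (measure_mono hsub).trans ((measure_biUnion_finset_le _ _).trans ?_)
  calc _ = ∑ J ∈ I.powersetCard M, complexNoise A ^ M :=
        Finset.sum_congr rfl fun J hJ => by
          rw [noiseLaw_forall_mem, (Finset.mem_powersetCard.1 hJ).2]
    _ = (I.card.choose M : ENNReal) * complexNoise A ^ M := by simp
    _ ≤ _ := by
      gcongr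
      exact_mod_cast Nat.choose_le_two_pow _ _

lemma exists_complexNoise_tail_le {η : ENNReal} (hη : 0 < η) :
    ∃ r : ℝ, 0 < r ∧ complexNoise {z | r ≤ ‖z‖} ≤ η := by
  have hlim : Tendsto (fun i : ℕ => complexNoise {z : ℂ | (i : ℝ) ≤ ‖z‖}) atTop
      (nhds (complexNoise (⋂ i : ℕ, {z : ℂ | (i : ℝ) ≤ ‖z‖}))) := by
    refine tendsto_measure_iInter_atTop (fun i => ?_) ?_ ⟨0, measure_ne_top _ _⟩
    · exact (measurableSet_le measurable_const measurable_norm).nullMeasurableSet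
    · intro i j hij z hz
      exact le_trans (Nat.cast_le.2 hij : (i : ℝ) ≤ j) (show (j : ℝ) ≤ ‖z‖ from hz)
  have hempty : (⋂ i : ℕ, {z : ℂ | (i : ℝ) ≤ ‖z‖}) = ∅ := by
    ext z
    simp only [Set.mem_iInter, Set.mem_ofPred_eq, Set.mem_empty_iff_false, iff_false, not_forall,
      not_le]
    exact exists_nat_gt _
  rw [hempty, measure_empty] at hlim
  obtain ⟨i, hi, hi0⟩ := ((hlim.eventually_lt_const hη).and (eventually_gt_atTop 0)).exists
  exact ⟨i, by exact_mod_cast hi0, hi.le⟩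

end Noise

/-! ### Zero forcing, measurable decoding and uncoded placement. -/

/-- A beamformer that reaches user `k` and is nulled at the users in `J`. -/
lemma GeneralPosition.exists_beamformer {U : Type} {L : ℕ} {h : U → EuclideanSpace ℂ (Fin L)}
    (hh : GeneralPosition h) {k : U} {J : Finset U} (hk : k ∉ J) (hJ : J.card < L) :
    ∃ v : EuclideanSpace ℂ (Fin L), inner ℂ (h k) v = 1 ∧ ∀ j ∈ J, inner ℂ (h j) v = 0 := by
  classical
  set V : Submodule ℂ (EuclideanSpace ℂ (Fin L)) := Submodule.span ℂ (h '' J) with hV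
  have hli := hh (insert k J) (by rw [Finset.card_insert_of_notMem hk]; exact hJ)
  have hnot : h k ∉ V := by
    have hk' : k ∈ insert k J := Finset.mem_insert_self k J
    have := hli.notMem_span_image (s := {x : (insert k J : Finset U) | (x : U) ∈ J})
      (x := ⟨k, hk'⟩) (by simpa using hk)
    refine fun hmem => this ?_
    convert hmem using 2
    ext y
    constructor
    · rintro ⟨x, hx, rfl⟩
      exact ⟨x, hx, rfl⟩
    · rintro ⟨x, hx, rfl⟩
      exact ⟨⟨x, Finset.mem_insert_of_mem hx⟩, hx, rfl⟩
  -- The component of `h k` orthogonal to the nulled channels is nonzero by general position.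
  set u := h k - V.starProjection (h k) with hu
  have huV : u ∈ Vᗮ := V.sub_starProjection_mem_orthogonal (h k)
  have hne : u ≠ 0 := by
    intro h0
    have : h k = V.starProjection (h k) := sub_eq_zero.1 h0
    exact hnot (this ▸ V.starProjection_apply_mem (h k))
  have hinner : inner ℂ (h k) u = inner ℂ u u := by
    have h1 : inner ℂ (V.starProjection (h k)) u = 0 :=
      (Submodule.mem_orthogonal V u).1 huV _ (V.starProjection_apply_mem (h k))
    have h2 : h k = u + V.starProjection (h k) := by simp [hu]
    conv_lhs => rw [h2]
    rw [inner_add_left, h1, add_zero]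
  have huu : inner ℂ u u ≠ (0 : ℂ) := inner_self_ne_zero.2 hne
  refine ⟨(inner ℂ u u : ℂ)⁻¹ • u, ?_, fun j hj => ?_⟩
  · rw [inner_smul_right, hinner, inv_mul_cancel₀ huu]
  · rw [inner_smul_right, (Submodule.mem_orthogonal V u).1 huV _
      (Submodule.subset_span ⟨j, hj, rfl⟩), mul_zero]

/-- A decoder for finitely many measurable decision regions. -/
lemma exists_measurable_decoder {Y M β : Type} [MeasurableSpace Y] [MeasurableSpace β] [Nonempty β]
    [Finite M] (A : M → Set Y) (hA : ∀ m, MeasurableSet (A m)) (val : M → β)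
    (hval : ∀ m m' y, y ∈ A m → y ∈ A m' → val m = val m') :
    ∃ dec : Y → β, Measurable dec ∧ ∀ m, ∀ y ∈ A m, dec y = val m := by
  classical
  have key : ∀ s : Set M, s.Finite → ∃ dec : Y → β, Measurable dec ∧
      ∀ m ∈ s, ∀ y ∈ A m, dec y = val m := by
    intro s hs
    induction s, hs using Set.Finite.induction_on with
    | empty => exact ⟨fun _ => Classical.arbitrary β, measurable_const, by simp⟩
    | @insert m s _ _ ih =>
      obtain ⟨dec, hdec, hval'⟩ := ih
      refine ⟨(A m).piecewise (fun _ => val m) dec, measurable_const.piecewise (hA m) hdec, ?_⟩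
      intro m' hm' y hy
      by_cases hym : y ∈ A m
      · rw [Set.piecewise_eq_of_mem _ _ _ hym]
        exact hval m m' y hym hy
      · rw [Set.piecewise_eq_of_notMem _ _ _ hym]
        rcases Set.mem_insert_iff.1 hm' with rfl | hm'
        · exact absurd hy hym
        · exact hval' m' hm' y hy
  obtain ⟨dec, h1, h2⟩ := key Set.univ Set.finite_univ
  exact ⟨dec, h1, fun m => h2 m trivial⟩

/-- User `k` stores the bits of every file at the positions `B k`. -/
noncomputable def uncodedPlacement {U : Type} (N F : ℕ) (B : U → Finset (Fin F)) : Placement U N F where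
  size k := N * (B k).card
  store k W i :=
    W (finProdFinEquiv.symm i).1 ((B k).equivFin.symm (finProdFinEquiv.symm i).2)

lemma uncodedPlacement_store_eq {U : Type} {N F : ℕ} {B : U → Finset (Fin F)} {k : U}
    {W W' : Library N F}
    (h : (uncodedPlacement N F B).store k W = (uncodedPlacement N F B).store k W')
    (a : Fin N) {b : Fin F} (hb : b ∈ B k) : W a b = W' a b := by
  have := congrFun h (finProdFinEquiv (a, (B k).equivFin ⟨b, hb⟩))
  simpa [uncodedPlacement] using this

/-! ### Coded transmission of a combinatorial scheme. -/

section Delivery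

variable {U Q S : Type} [Fintype U] [Fintype Q] {N F L f n₀ m M : ℕ}

open Classical in
/-- The superposition of the codewords of all pieces sent in a slot, each one along its own
beamformer. -/
noncomputable def superposition (C : U → Finset Q) (slot : U → Q → S)
    (v : U → Q → EuclideanSpace ℂ (Fin L)) (σ : U → Q → ℂ) (ρ : S) :
    EuclideanSpace ℂ (Fin L) :=
  ∑ k, ∑ q, if q ∉ C k ∧ slot k q = ρ then σ k q • v k q else 0

lemma norm_superposition_le (C : U → Finset Q) (slot : U → Q → S)
    (v : U → Q → EuclideanSpace ℂ (Fin L)) {σ : U → Q → ℂ} {b : ℝ}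
    (hσ : ∀ k q, ‖σ k q‖ ≤ b) (hb : 0 ≤ b) (ρ : S) :
    ‖superposition C slot v σ ρ‖ ≤ b * ∑ k, ∑ q, ‖v k q‖ := by
  rw [superposition, Finset.mul_sum]
  refine (norm_sum_le _ _).trans (Finset.sum_le_sum fun k _ => ?_)
  rw [Finset.mul_sum]
  refine (norm_sum_le _ _).trans (Finset.sum_le_sum fun q _ => ?_)
  split_ifs
  · rw [norm_smul]
    exact mul_le_mul_of_nonneg_right (hσ k q) (norm_nonneg _)
  · rw [norm_zero]; positivity

/-- If two sets of symbols agree on the pieces that user `k` caches, then user `k` sees the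
difference of its own symbols only. -/
lemma inner_superposition_sub {C : U → Finset Q} {served : S → Set U} {slot : U → Q → S}
    {h : U → EuclideanSpace ℂ (Fin L)} {v : U → Q → EuclideanSpace ℂ (Fin L)}
    (hmem : ∀ k q, q ∉ C k → k ∈ served (slot k q))
    (hinj : ∀ k q q', q ∉ C k → q' ∉ C k → slot k q = slot k q' → q = q')
    (hv : ∀ k q, q ∉ C k → inner ℂ (h k) (v k q) = 1)
    (hnull : ∀ k q, q ∉ C k → ∀ j ∈ served (slot k q), j ≠ k → q ∉ C j →
      inner ℂ (h j) (v k q) = 0)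
    {σ σ' : U → Q → ℂ} {k : U} {q : Q} (hq : q ∉ C k)
    (hσ : ∀ j, ∀ p ∈ C k, σ j p = σ' j p) :
    inner ℂ (h k) (superposition C slot v σ (slot k q)) -
      inner ℂ (h k) (superposition C slot v σ' (slot k q)) = σ k q - σ' k q := by
  classical
  rw [← inner_sub_right, superposition, superposition, ← Finset.sum_sub_distrib]
  simp_rw [← Finset.sum_sub_distrib]
  rw [inner_sum, Finset.sum_eq_single k]
  · rw [inner_sum, Finset.sum_eq_single q]
    · rw [if_pos ⟨hq, rfl⟩, if_pos ⟨hq, rfl⟩, ← sub_smul, inner_smul_right, hv k q hq, mul_one]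
    · intro p _ hp
      have : ¬(p ∉ C k ∧ slot k p = slot k q) := fun hc => hp (hinj k p q hc.1 hq hc.2)
      rw [if_neg this, if_neg this, sub_zero, inner_zero_right]
    · simp
  · intro j _ hj
    rw [inner_sum]
    refine Finset.sum_eq_zero fun p _ => ?_
    by_cases hc : p ∉ C j ∧ slot j p = slot k q
    · rw [if_pos hc, if_pos hc, ← sub_smul, inner_smul_right]
      by_cases hp : p ∈ C k
      · rw [hσ j p hp, sub_self, zero_mul]
      · rw [hnull j p hc.1 k (hc.2 ▸ hmem k q hq) (Ne.symm hj) hp, mul_zero]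
    · rw [if_neg hc, if_neg hc, sub_zero, inner_zero_right]
  · simp

/-- With spacing `2 * r`, noise below `r` cannot confuse two symbols; with distance `2 * M`, fewer
than `M` larger noise values in a slot cannot confuse two codewords. The decoder compares whole
libraries that agree with the cache, so interference from cached pieces cancels in differences. The
error bound is a union bound over users and slots. -/
lemma exists_delivery [Fintype S] {C : U → Finset Q} {served : S → Set U} {slot : U → Q → S}
    {h : U → EuclideanSpace ℂ (Fin L)} {v : U → Q → EuclideanSpace ℂ (Fin L)}
    (hmem : ∀ k q, q ∉ C k → k ∈ served (slot k q))
    (hinj : ∀ k q q', q ∉ C k → q' ∉ C k → slot k q = slot k q' → q = q')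
    (hv : ∀ k q, q ∉ C k → inner ℂ (h k) (v k q) = 1)
    (hnull : ∀ k q, q ∉ C k → ∀ j ∈ served (slot k q), j ≠ k → q ∉ C j →
      inner ℂ (h j) (v k q) = 0)
    {enc : (Fin f → Bool) → Fin n₀ → Fin m × Fin m}
    (henc : ∀ a a', a ≠ a' → 2 * M ≤ hammingDist (enc a) (enc a'))
    {r : ℝ} (hr : 0 ≤ r) {η : ENNReal} (hη : complexNoise {z | r ≤ ‖z‖} ≤ η)
    (e : Fin F ≃ Q × Fin f) {Z : Placement U N F}
    (hZ : ∀ k W W', Z.store k W = Z.store k W' → ∀ a, ∀ q ∈ C k, ∀ b,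
      W a (e.symm (q, b)) = W' a (e.symm (q, b)))
    {P : ℝ} (hP0 : 0 ≤ P) (hP : (2 * (2 * r) * m) * ∑ k, ∑ q, ‖v k q‖ ≤ √P)
    (d : U → Fin N) :
    ∃ D : Delivery Z L (Fintype.card S * n₀), D.PowerAtMost P ∧
      ∀ W : Library N F, noiseLaw U (Fintype.card S * n₀)
        {w | ∃ k, D.decode k (Z.store k W) (D.received h W w k) ≠ W (d k)}
        ≤ Fintype.card U * (Fintype.card S * (2 ^ n₀ * η ^ M)) := by
  classical
  let E : S × Fin n₀ ≃ Fin (Fintype.card S * n₀) :=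
    (Equiv.prodCongr (Fintype.equivFin S) (Equiv.refl _)).trans finProdFinEquiv
  let piece : Library N F → U → Q → Fin f → Bool := fun W k q b => W (d k) (e.symm (q, b))
  let sym : Library N F → Fin n₀ → U → Q → ℂ := fun W j k q =>
    gridPoint (2 * r) (enc (piece W k q) j)
  let x : Library N F → Fin (Fintype.card S * n₀) → EuclideanSpace ℂ (Fin L) := fun W i =>
    superposition C slot v (sym W (E.symm i).2) (E.symm i).1
  -- The power bound holds for every library, not only on average.
  have hx : ∀ W i, ‖x W i‖ ≤ √P := fun W i =>
    (norm_superposition_le C slot v (fun k q => norm_gridPoint_le (by positivity) _)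
      (by positivity) _).trans hP
  let bad : U → Library N F → S → (Fin (Fintype.card S * n₀) → ℂ) → Finset (Fin n₀) :=
    fun k W ρ y =>
      Finset.univ.filter fun j => r ≤ ‖y (E (ρ, j)) - inner ℂ (h k) (x W (E (ρ, j)))‖
  let Typ : U → Library N F → Set (Fin (Fintype.card S * n₀) → ℂ) :=
    fun k W => {y | ∀ ρ, (bad k W ρ y).card < M}
  have hTyp : ∀ k W, MeasurableSet (Typ k W) := by
    intro k W
    have : Typ k W = ⋂ ρ, {y | (bad k W ρ y).card < M} := by
      ext y; simp [Typ]
    rw [this]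
    refine MeasurableSet.iInter fun ρ => measurableSet_lt ?_ measurable_const
    simp only [bad, Finset.card_filter]
    refine Finset.measurable_sum _ fun j _ => Measurable.ite ?_ measurable_const measurable_const
    exact measurableSet_le measurable_const (by fun_prop)
  have hkey : ∀ k W W' y, Z.store k W = Z.store k W' → y ∈ Typ k W → y ∈ Typ k W' →
      W (d k) = W' (d k) := by
    intro k W W' y hst hy hy'
    have hpiece : ∀ q, piece W k q = piece W' k q := by
      intro q
      by_cases hq : q ∈ C k
      · funext b; exact hZ k W W' hst _ q hq b
      by_contra hne
      have hdist := henc _ _ hne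
      -- Outside both bad sets the same output would be within `r` of two signals whose difference,
      -- that of the symbols, is at least `2 * r`.
      have hsub : (Finset.univ.filter fun j => enc (piece W k q) j ≠ enc (piece W' k q) j) ⊆
          bad k W (slot k q) y ∪ bad k W' (slot k q) y := by
        intro j hj
        simp only [Finset.mem_filter, Finset.mem_univ, true_and] at hj
        by_contra hcon
        simp only [bad, Finset.mem_union, Finset.mem_filter, Finset.mem_univ, true_and,
          not_or, not_le] at hcon
        have hsep := le_norm_gridPoint_sub (s := 2 * r) (by positivity) hj
        have hid : inner ℂ (h k) (x W (E (slot k q, j))) -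
            inner ℂ (h k) (x W' (E (slot k q, j))) = sym W j k q - sym W' j k q := by
          simp only [x, Equiv.symm_apply_apply]
          refine inner_superposition_sub hmem hinj hv hnull hq fun j' p hp => ?_
          have : piece W j' p = piece W' j' p := by
            funext b; exact hZ k W W' hst _ p hp b
          simp only [sym, this]
        have htri : ‖sym W j k q - sym W' j k q‖ < r + r := by
          rw [← hid]
          refine lt_of_le_of_lt ?_ (add_lt_add hcon.2 hcon.1)
          refine le_trans (le_of_eq ?_) (norm_sub_le _ _)
          congr 1
          ring
        have : (2 * r) ≤ ‖sym W j k q - sym W' j k q‖ := hsep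
        linarith
      have hcard := (Finset.card_le_card hsub).trans (Finset.card_union_le _ _)
      have h1 := hy (slot k q)
      have h2 := hy' (slot k q)
      have h3 : hammingDist (enc (piece W k q)) (enc (piece W' k q)) =
        (Finset.univ.filter fun j => enc (piece W k q) j ≠ enc (piece W' k q) j).card := rfl
      omega
    funext b
    have := congrFun (hpiece (e b).1) (e b).2
    simpa [piece] using this
  have hdec : ∀ k z, ∃ dec : (Fin (Fintype.card S * n₀) → ℂ) → File F, Measurable dec ∧
      ∀ W : {W : Library N F // Z.store k W = z}, ∀ y ∈ Typ k W, dec y = (W : Library N F) (d k) :=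
    fun k z => exists_measurable_decoder (M := {W : Library N F // Z.store k W = z})
      (fun W => Typ k W) (fun W => hTyp k W) (fun W => (W : Library N F) (d k))
      (fun W W' y hy hy' => hkey k W W' y (W.2.trans W'.2.symm) hy hy')
  choose dec hmeas hdec using hdec
  refine ⟨⟨x, dec, hmeas⟩, ?_, ?_⟩
  · intro i
    have hpos : (0 : ℝ) < (Fintype.card (Library N F) : ℝ) := by
      exact_mod_cast Fintype.card_pos
    rw [div_le_iff₀ hpos]
    calc _ ≤ ∑ _W : Library N F, P := Finset.sum_le_sum fun W _ => by
          have := hx W i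
          calc ‖x W i‖ ^ 2 ≤ √P ^ 2 := by gcongr
            _ = P := Real.sq_sqrt hP0
      _ = _ := by simp [mul_comm]
  · intro W
    obtain ⟨A, hA⟩ : ∃ A : Set ℂ, A = {z | r ≤ ‖z‖} := ⟨_, rfl⟩
    rw [← hA] at hη
    have hsub : {w : U → Fin (Fintype.card S * n₀) → ℂ |
          ∃ k, dec k (Z.store k W) (Delivery.received (Z := Z) ⟨x, dec, hmeas⟩ h W w k) ≠ W (d k)} ⊆
        ⋃ k, ⋃ ρ, {w | M ≤ ((Finset.univ.map
            ⟨fun j : Fin n₀ => E (ρ, j), fun a b hab => by simpa using hab⟩).filter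
              fun i => w k i ∈ A).card} := by
      rintro w ⟨k, hk⟩
      have hnot : Delivery.received (Z := Z) ⟨x, dec, hmeas⟩ h W w k ∉ Typ k W := fun hy =>
        hk (hdec k _ ⟨W, rfl⟩ _ hy)
      simp only [Typ, Set.mem_ofPred_eq, not_forall, not_lt] at hnot
      obtain ⟨ρ, hρ⟩ := hnot
      simp only [Set.mem_iUnion]
      refine ⟨k, ρ, hρ.trans ?_⟩
      rw [Finset.filter_map, Finset.card_map]
      refine Finset.card_le_card fun j hj => ?_
      simp only [bad, Delivery.received, Finset.mem_filter, Finset.mem_univ, true_and,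
        add_sub_cancel_left] at hj
      simp only [hA, Finset.mem_filter, Finset.mem_univ, true_and]
      exact hj
    refine (measure_mono hsub).trans ((measure_iUnion_fintype_le _ _).trans ?_)
    have hone : ∀ (k : U) (ρ : S), noiseLaw U (Fintype.card S * n₀)
        {w | M ≤ ((Finset.univ.map
            ⟨fun j : Fin n₀ => E (ρ, j), fun a b hab => by simpa using hab⟩).filter
              fun i => w k i ∈ A).card} ≤ 2 ^ n₀ * η ^ M := by
      intro k ρ
      refine (noiseLaw_le_card_filter_le k _ A M).trans ?_
      rw [Finset.card_map, Finset.card_univ, Fintype.card_fin]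
      gcongr
    calc _ ≤ ∑ _k : U, ∑ _ρ : S, (2 ^ n₀ * η ^ M) := Finset.sum_le_sum fun k _ =>
          (measure_iUnion_fintype_le _ _).trans (Finset.sum_le_sum fun ρ _ => hone k ρ)
      _ = _ := by simp

end Delivery

/-! ### Choice of parameters and the rate computation. -/

/-- Splitting files of `F = D * f` bits into `D` pieces. -/
lemma exists_bit_positions {U Q : Type} [Fintype Q] [Nonempty Q] {γ : U → ℝ} (C : U → Finset Q)
    (hγ : ∀ k, ((C k).card : ℝ) ≤ γ k * Fintype.card Q) (F : ℕ) :
    ∃ B : U → Finset (Fin F), (∀ k, ((B k).card : ℝ) ≤ γ k * F) ∧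
      ∀ f, F = Fintype.card Q * f → ∃ e : Fin F ≃ Q × Fin f,
        ∀ k q b, q ∈ C k → e.symm (q, b) ∈ B k := by
  classical
  have hQ : (0 : ℝ) < Fintype.card Q := by exact_mod_cast Fintype.card_pos
  have hγ0 : ∀ k, 0 ≤ γ k := fun k => by
    have : (0 : ℝ) ≤ γ k * Fintype.card Q := le_trans (Nat.cast_nonneg _) (hγ k)
    exact nonneg_of_mul_nonneg_left this hQ
  by_cases hF : Fintype.card Q ∣ F
  · obtain ⟨f, rfl⟩ := hF
    let e : Fin (Fintype.card Q * f) ≃ Q × Fin f :=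
      finProdFinEquiv.symm.trans (Equiv.prodCongr (Fintype.equivFin Q).symm (Equiv.refl _))
    refine ⟨fun k => (C k ×ˢ Finset.univ).map e.symm.toEmbedding, fun k => ?_, fun f' hf => ?_⟩
    · rw [Finset.card_map, Finset.card_product, Finset.card_univ, Fintype.card_fin]
      push_cast
      rw [← mul_assoc]
      exact mul_le_mul_of_nonneg_right (hγ k) (Nat.cast_nonneg _)
    · obtain rfl := Nat.eq_of_mul_eq_mul_left Fintype.card_pos hf
      exact ⟨e, fun k q b hq => by simpa using hq⟩
  -- Only a sequence of arbitrarily large `F` has to work, so nothing need be cached for the other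
  -- lengths.
  · exact ⟨fun _ => ∅, fun k => by simpa using mul_nonneg (hγ0 k) (Nat.cast_nonneg F),
      fun f hf => absurd ⟨f, hf⟩ hF⟩

/-- The alphabet size exponent and the block lengths are eventually large enough. -/
lemma eventually_exists_alphabet {T ε b : ℝ} (hT : 0 < T) (hb : 0 < b) {k₀ : ℕ} (hk₀ : 2 ≤ k₀)
    (h : T * k₀ < (T + ε) * (k₀ - 2)) :
    ∀ᶠ P : ℝ in atTop, 0 < P ∧ ∃ β g : ℕ, b * 2 ^ β ≤ √P ∧ 0 < g ∧ g + k₀ = (k₀ - 2) * (2 * β) ∧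
      T * k₀ * Real.logb 2 P ≤ (T + ε) * g := by
  set κ : ℝ := 2 * Real.logb 2 b + 2 with hκ
  have hk2 : (2 : ℝ) ≤ k₀ := by exact_mod_cast hk₀
  have hTk : 0 < T * k₀ := by positivity
  have hTε : 0 < T + ε := by
    by_contra hc
    nlinarith
  have hk3 : (0 : ℝ) < k₀ - 2 := by
    by_contra hc
    nlinarith
  have hlog := Real.tendsto_logb_atTop (b := 2) (by norm_num)
  -- Threshold for `(T + ε) * ((k₀ - 2) * (log₂ P - κ) - k₀)` to dominate `T * k₀ * log₂ P`; `h`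
  -- makes the denominator positive. In `κ`, the last `2` pays for rounding `β` down.
  have e1 : ∀ᶠ P : ℝ in atTop, (T + ε) * ((k₀ - 2) * κ + k₀) /
      ((T + ε) * (k₀ - 2) - T * k₀) ≤ Real.logb 2 P := hlog.eventually_ge_atTop _
  have e2 : ∀ᶠ P : ℝ in atTop, 1 ≤ Real.logb 2 P := hlog.eventually_ge_atTop _
  have e3 : ∀ᶠ P : ℝ in atTop, b ^ 2 ≤ P := eventually_ge_atTop _
  filter_upwards [e1, e2, e3, eventually_gt_atTop 0] with P h1 h2 h3 hP
  refine ⟨hP, ?_⟩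
  have hsq : 0 < √P := Real.sqrt_pos.2 hP
  have hx1 : 1 ≤ √P / b := by
    rw [one_le_div hb]; exact Real.le_sqrt_of_sq_le h3
  have hx0 : 0 < √P / b := by positivity
  set y := Real.logb 2 (√P / b) with hy
  have hy0 : 0 ≤ y := Real.logb_nonneg (by norm_num) hx1
  have hyP : 2 * y = Real.logb 2 P - 2 * Real.logb 2 b := by
    rw [hy, Real.logb_div hsq.ne' hb.ne', Real.sqrt_eq_rpow, Real.logb_rpow_eq_mul_logb_of_pos hP]
    ring
  set β := ⌊y⌋₊ with hβ
  have hβ1 : (β : ℝ) ≤ y := Nat.floor_le hy0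
  have hβ2 : y < β + 1 := Nat.lt_floor_add_one y
  have hβκ : Real.logb 2 P - κ ≤ 2 * β := by rw [hκ]; linarith
  rw [div_le_iff₀ (by linarith)] at h1
  have hmain : T * k₀ * Real.logb 2 P ≤ (T + ε) * ((k₀ - 2) * (2 * β) - k₀) := by
    have : (T + ε) * (k₀ - 2) * (Real.logb 2 P - κ) ≤ (T + ε) * (k₀ - 2) * (2 * β) :=
      mul_le_mul_of_nonneg_left hβκ (by positivity)
    nlinarith
  have hpos : (0 : ℝ) < (k₀ - 2) * (2 * β) - k₀ := by
    have : 0 < T * k₀ * Real.logb 2 P := by positivity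
    exact pos_of_mul_pos_right (this.trans_le hmain) hTε.le
  have hlt : k₀ < (k₀ - 2) * (2 * β) := by
    have : (k₀ : ℝ) < ((k₀ - 2 : ℕ) : ℝ) * (2 * β) := by
      rw [Nat.cast_sub hk₀]; push_cast; linarith
    exact_mod_cast this
  refine ⟨β, (k₀ - 2) * (2 * β) - k₀, ?_, by omega, by omega, ?_⟩
  · have : (2 : ℝ) ^ β ≤ √P / b := by
      rw [← Real.rpow_natCast, ← Real.le_logb_iff_rpow_le (by norm_num) hx0]
      exact hβ1
    rw [le_div_iff₀ hb] at this
    linarith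
  · rw [Nat.cast_sub hlt.le, Nat.cast_mul, Nat.cast_sub hk₀]
    push_cast
    exact hmain

/-- A slot takes `k₀ * M` channel uses and a piece has `g * M` bits. The choices respect the
quantifiers: `k₀` and `r` depend on `ε`, `b` also on the channel, `β` and `g` also on `P`, and only
`M` on `δ`. -/
theorem HasScheme.achievableDelay {U : Type} [Fintype U] {γ : U → ℝ} {L N D R : ℕ} {c : U → ℕ}
    {T : ℝ} (hs : HasScheme U L D R c) (hD : 0 < D) (hc : ∀ k, (c k : ℝ) ≤ γ k * D)
    (hR : (R : ℝ) ≤ T * D) (hT : 0 < T) : AchievableDelay γ L N T := by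
  classical
  obtain ⟨Q, S, _, _, C, served, slot, rfl, rfl, hcard, hmem, hinj, hzf⟩ := hs
  have : Nonempty Q := Fintype.card_pos_iff.1 hD
  choose B hB hsplit using exists_bit_positions C (fun k => (hcard k).symm ▸ hc k)
  refine ⟨fun F => uncodedPlacement N F (B F), fun F k => ?_, fun h hgp ε hε => ?_⟩
  · have := mul_le_mul_of_nonneg_left (hB F k) (Nat.cast_nonneg (α := ℝ) N)
    simp only [uncodedPlacement]
    push_cast
    linarith
  have hbeam : ∀ k q, ∃ v : EuclideanSpace ℂ (Fin L), q ∉ C k → inner ℂ (h k) v = 1 ∧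
      ∀ j ∈ served (slot k q), j ≠ k → q ∉ C j → inner ℂ (h j) v = 0 := by
    intro k q
    by_cases hq : q ∈ C k
    · exact ⟨0, fun hn => absurd hq hn⟩
    obtain ⟨J, hkJ, hJ, hserved⟩ := hzf k q hq
    obtain ⟨v, hv1, hv0⟩ := hgp.exists_beamformer hkJ hJ
    exact ⟨v, fun _ => ⟨hv1, fun j hj hjk hqj => hv0 j ((hserved j hj hjk).resolve_left hqj)⟩⟩
  choose v hv using hbeam
  -- Distance `2 * M` in length `k₀ * M` costs the fraction `2 / k₀` of the rate, which the slack
  -- `ε` must cover; the final `+ 2` ensures `k₀ > 2`.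
  obtain ⟨k₀, hk₀⟩ := exists_nat_gt (2 * (T + ε) / ε + 2)
  have hk2' : (2 : ℝ) < k₀ := lt_of_le_of_lt (by have : 0 ≤ 2 * (T + ε) / ε := by positivity
                                                 linarith) hk₀
  have hk2 : 2 ≤ k₀ := by exact_mod_cast hk2'.le
  have hk₀T : T * k₀ < (T + ε) * (k₀ - 2) := by
    have : 2 * (T + ε) / ε < k₀ := by linarith
    rw [div_lt_iff₀ hε] at this
    nlinarith
  -- The tail `4 ^ (-k₀)` to the power `M` beats the `2 ^ (k₀ * M)` of the union bound, leaving `2 ^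
  -- (-k₀ * M)`.
  obtain ⟨r, hr, hη⟩ := exists_complexNoise_tail_le
    (η := ENNReal.ofReal ((1 / 4) ^ k₀)) (by rw [ENNReal.ofReal_pos]; positivity)
  set b : ℝ := 4 * r * (1 + ∑ k, ∑ q, ‖v k q‖) with hb
  have hsum : 0 ≤ ∑ k, ∑ q, ‖v k q‖ :=
    Finset.sum_nonneg fun _ _ => Finset.sum_nonneg fun _ _ => norm_nonneg _
  filter_upwards [eventually_exists_alphabet hT (b := b) (by positivity) hk2 hk₀T] with P hP δ hδ
  obtain ⟨hP0, β, g, hβ, hg, hgk, hrate⟩ := hP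
  have hlim : Tendsto (fun M : ℕ => (Fintype.card U * Fintype.card S : ℝ) * (1 / 2) ^ (k₀ * M))
      atTop (nhds 0) := by
    have h1 : Tendsto (fun n : ℕ => ((1 : ℝ) / 2) ^ n) atTop (nhds 0) :=
      tendsto_pow_atTop_nhds_zero_of_lt_one (by norm_num) (by norm_num)
    have h2 : Tendsto (fun M : ℕ => k₀ * M) atTop atTop :=
      tendsto_id.const_mul_atTop' (by omega)
    simpa using (h1.comp h2).const_mul (Fintype.card U * Fintype.card S : ℝ)
  rw [frequently_atTop]
  intro F₀
  obtain ⟨M, hMδ, hM0, hMF⟩ := ((hlim.eventually_lt_const hδ).and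
    ((eventually_gt_atTop 0).and (eventually_ge_atTop F₀))).exists
  refine ⟨Fintype.card Q * (g * M), ?_, fun d _ => ?_⟩
  · exact hMF.trans (by rw [← mul_assoc]; exact Nat.le_mul_of_pos_left _ (by positivity))
  obtain ⟨e, he⟩ := hsplit (Fintype.card Q * (g * M)) (g * M) rfl
  have : Nonempty (Fin (2 ^ β) × Fin (2 ^ β)) := ⟨0, 0⟩
  -- With `4 ^ β` symbols the counting condition reads `g + k₀ + 4 * β ≤ 2 * β * k₀`; the choice of
  -- `g` makes it an equality.
  obtain ⟨enc, henc⟩ := exists_code (Q := Fin (2 ^ β) × Fin (2 ^ β)) (n := k₀ * M) (d := 2 * M)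
    (f := g * M) (by omega) (by
      rw [Fintype.card_prod, Fintype.card_fin, ← pow_add, ← pow_mul, ← pow_mul, ← pow_add,
        ← pow_add]
      refine Nat.pow_le_pow_right (by norm_num) (le_of_eq ?_)
      obtain ⟨k₁, rfl⟩ := Nat.exists_eq_add_of_le hk2
      rw [Nat.add_sub_cancel_left] at hgk
      calc _ = (g + (2 + k₁) + 4 * β) * M := by ring
        _ = _ := by rw [hgk]; ring)
  obtain ⟨Dl, hDl, herr⟩ := exists_delivery hmem hinj (fun k q hq => (hv k q hq).1)
    (fun k q hq => (hv k q hq).2) henc hr.le hη e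
    (Z := uncodedPlacement N _ (B (Fintype.card Q * (g * M))))
    (fun k W W' hst a q hq b => uncodedPlacement_store_eq hst a (he k q b hq)) hP0.le (by
      refine le_trans ?_ hβ
      rw [hb]
      push_cast
      nlinarith [mul_nonneg hr.le (pow_nonneg (zero_le_two (α := ℝ)) β)]) d
  refine ⟨_, ?_, Dl, hDl, fun W => (herr W).trans ?_⟩
  · push_cast
    have hlogP : 0 ≤ k₀ * Real.logb 2 P * M ∨ k₀ * Real.logb 2 P * M ≤ 0 := le_total _ _
    have hQ : (0 : ℝ) < Fintype.card Q := by exact_mod_cast hD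
    rcases hlogP with hl | hl
    · calc (Fintype.card S : ℝ) * (k₀ * M) * Real.logb 2 P
          = Fintype.card S * (k₀ * Real.logb 2 P * M) := by ring
        _ ≤ T * Fintype.card Q * (k₀ * Real.logb 2 P * M) := mul_le_mul_of_nonneg_right hR hl
        _ = (T * k₀ * Real.logb 2 P) * (Fintype.card Q * M) := by ring
        _ ≤ (T + ε) * g * (Fintype.card Q * M) := mul_le_mul_of_nonneg_right hrate (by positivity)
        _ = _ := by ring
    · calc (Fintype.card S : ℝ) * (k₀ * M) * Real.logb 2 P
          = Fintype.card S * (k₀ * Real.logb 2 P * M) := by ring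
        _ ≤ 0 := mul_nonpos_of_nonneg_of_nonpos (Nat.cast_nonneg _) hl
        _ ≤ _ := by positivity
  · have hconv : (Fintype.card U : ENNReal) * (Fintype.card S * (2 ^ (k₀ * M) *
        ENNReal.ofReal ((1 / 4) ^ k₀) ^ M)) = ENNReal.ofReal
        ((Fintype.card U * Fintype.card S : ℝ) * (1 / 2) ^ (k₀ * M)) := by
      have h2 : (2 : ENNReal) = ENNReal.ofReal 2 := by simp
      rw [← ENNReal.ofReal_natCast (Fintype.card U), ← ENNReal.ofReal_natCast (Fintype.card S), h2,
        ← ENNReal.ofReal_pow (by positivity), ← ENNReal.ofReal_pow (by positivity),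
        ← ENNReal.ofReal_mul (by positivity), ← ENNReal.ofReal_mul (by positivity),
        ← ENNReal.ofReal_mul (by positivity), ← pow_mul, ← mul_pow]
      congr 1
      norm_num
      ring
    rw [hconv]
    exact ENNReal.ofReal_le_ofReal hMδ.le

/-! ### Combining schemes, orbits of base schemes, and permutations. -/

section Combinatorics

variable {U : Type} {L : ℕ}

lemma HasScheme.zero : HasScheme U L 0 0 0 :=
  ⟨Empty, Empty, inferInstance, inferInstance, fun _ => ∅, Empty.elim, fun _ => id,
    rfl, rfl, fun _ => rfl, fun _ q => q.elim, fun _ q => q.elim, fun _ q => q.elim⟩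

/-- Two schemes, each one applied to a part of every file. -/
lemma HasScheme.add {D R D' R' : ℕ} {c c' : U → ℕ} (hs : HasScheme U L D R c)
    (hs' : HasScheme U L D' R' c') : HasScheme U L (D + D') (R + R') (c + c') := by
  obtain ⟨Q, S, _, _, C, served, slot, rfl, rfl, hc, hm, hi, hz⟩ := hs
  obtain ⟨Q', S', _, _, C', served', slot', rfl, rfl, hc', hm', hi', hz'⟩ := hs'
  refine ⟨Q ⊕ Q', S ⊕ S', inferInstance, inferInstance, fun k => (C k).disjSum (C' k),
    Sum.elim served served', fun k => Sum.map (slot k) (slot' k), Fintype.card_sum,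
    Fintype.card_sum, ?_, ?_, ?_, ?_⟩
  · intro k; simp [hc, hc']
  · rintro k (q | q) hq <;> simp at hq ⊢
    · exact hm k q hq
    · exact hm' k q hq
  · rintro k (q | q) (p | p) hq hp h <;> simp at hq hp h ⊢
    · exact hi k q p hq hp h
    · exact hi' k q p hq hp h
  · rintro k (q | q) hq <;> simp at hq
    · simpa using hz k q hq
    · simpa using hz' k q hq

lemma HasScheme.nsmul {D R : ℕ} {c : U → ℕ} (hs : HasScheme U L D R c) (w : ℕ) :
    HasScheme U L (w * D) (w * R) (w • c) := by
  induction w with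
  | zero => simpa using HasScheme.zero
  | succ w ih => rw [add_mul, add_mul, add_smul]; simpa using ih.add hs

/-- The orbit of a base scheme under a group that acts on the users. -/
lemma hasScheme_of_orbit {G A B : Type} [Group G] [Fintype G] [Fintype A] [Fintype B]
    [DecidableEq U] (φ : G →* Equiv.Perm U) (τ : A → Finset U) (s : B → Finset U)
    (next : U → A → U × B)
    (hinj : ∀ p a p' a', p ∉ τ a → p' ∉ τ a' → next p a = next p' a' → p = p' ∧ a = a')
    (hnext : ∀ p a, p ∉ τ a → (next p a).1 ∈ s (next p a).2 ∧
      ∃ σ : G, φ σ p = (next p a).1 ∧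
        (s (next p a).2 \ (insert p (τ a)).map (φ σ).toEmbedding).card < L) :
    HasScheme U L (Fintype.card G * Fintype.card A) (Fintype.card G * Fintype.card B)
      (fun k => ∑ a, (Finset.univ.filter fun g : G => φ g k ∈ τ a).card) := by
  classical
  have : ∀ p a, ∃ σ : G, p ∉ τ a → φ σ p = (next p a).1 ∧
        (s (next p a).2 \ (insert p (τ a)).map (φ σ).toEmbedding).card < L := by
    intro p a
    by_cases hp : p ∈ τ a
    · exact ⟨1, fun h => absurd hp h⟩
    · obtain ⟨σ, hσ⟩ := (hnext p a hp).2
      exact ⟨σ, fun _ => hσ⟩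
  choose σ hσ using this
  -- In the copy `g`, user `k` stands at position `φ g k`. Multiplying `g` by `σ` moves it to its
  -- assigned place in the slot, and moves the users that cache the piece along with it.
  refine ⟨G × A, G × B, inferInstance, inferInstance,
    fun k => Finset.univ.filter fun x => φ x.1 k ∈ τ x.2,
    fun y => {k | φ y.1 k ∈ s y.2},
    fun k x => (σ (φ x.1 k) x.2 * x.1, (next (φ x.1 k) x.2).2),
    Fintype.card_prod _ _, Fintype.card_prod _ _, ?_, ?_, ?_, ?_⟩
  · intro k
    simp only [Finset.card_filter]
    rw [Fintype.sum_prod_type_right]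
  · rintro k ⟨g, a⟩ hq
    simp only [Finset.mem_filter, Finset.mem_univ, true_and] at hq
    simp only [Set.mem_ofPred_eq, map_mul, Equiv.Perm.mul_apply]
    rw [(hσ _ _ hq).1]
    exact (hnext _ _ hq).1
  · rintro k ⟨g, a⟩ ⟨g', a'⟩ hq hq' h
    simp only [Finset.mem_filter, Finset.mem_univ, true_and] at hq hq'
    simp only [Prod.mk.injEq] at h
    -- The slot fixes its group element, hence the place of `k` in it; so injectivity of `next`
    -- applies.
    have h1 : (next (φ g k) a).1 = (next (φ g' k) a').1 := by
      rw [← (hσ _ _ hq).1, ← (hσ _ _ hq').1, ← Equiv.Perm.mul_apply, ← Equiv.Perm.mul_apply,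
        ← map_mul, ← map_mul, h.1]
    obtain ⟨h2, rfl⟩ := hinj _ _ _ _ hq hq' (Prod.ext h1 h.2)
    have h3 := h.1
    rw [h2] at h3
    rw [mul_left_cancel h3]
  · rintro k ⟨g, a⟩ hq
    simp only [Finset.mem_filter, Finset.mem_univ, true_and] at hq
    set p := φ g k with hp
    have hcard := (hσ p a hq).2
    have hk := (hσ p a hq).1
    -- The served places covered neither by `k` nor by users that cache the piece, pulled back to
    -- users.
    refine ⟨(s (next p a).2 \ (insert p (τ a)).map (φ (σ p a)).toEmbedding).map
      (φ (σ p a * g)).symm.toEmbedding, ?_, by rwa [Finset.card_map], ?_⟩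
    · simp only [Finset.mem_map_equiv, Equiv.symm_symm, map_mul, Equiv.Perm.mul_apply, ← hp,
        Finset.mem_sdiff, not_and, not_not]
      intro _
      simp
    · intro j hj hjk
      simp only [Set.mem_ofPred_eq] at hj
      by_cases hjt : φ g j ∈ τ a
      · left; simpa using hjt
      · right
        simp only [Finset.mem_map_equiv, Equiv.symm_symm, Finset.mem_sdiff]
        refine ⟨hj, ?_⟩
        simp only [map_mul, Equiv.Perm.mul_apply, Equiv.symm_apply_apply, Finset.mem_insert, not_or]
        refine ⟨fun h => hjk ?_, hjt⟩
        exact (φ g).injective (h.trans hp)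

/-- The number of group elements that move a point into a given set, for a transitive family. -/
lemma card_mul_card_filter_perm {α : Type} [Fintype α] [DecidableEq α] (k : α) (X : Finset α) :
    Fintype.card α * (Finset.univ.filter fun g : Equiv.Perm α => g k ∈ X).card =
      Fintype.card (Equiv.Perm α) * X.card := by
  have hsame : ∀ j : α, (Finset.univ.filter fun g : Equiv.Perm α => g j ∈ X).card =
      (Finset.univ.filter fun g : Equiv.Perm α => g k ∈ X).card := by
    intro j
    refine Finset.card_equiv (Equiv.mulRight (Equiv.swap j k)) fun g => ?_
    simp
  have h1 : ∑ j : α, (Finset.univ.filter fun g : Equiv.Perm α => g j ∈ X).card =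
      Fintype.card α * (Finset.univ.filter fun g : Equiv.Perm α => g k ∈ X).card := by
    rw [Finset.sum_congr rfl fun j _ => hsame j]; simp
  rw [← h1]
  simp only [Finset.card_filter]
  rw [Finset.sum_comm, ← Finset.card_univ (α := Equiv.Perm α), ← smul_eq_mul,
    ← Finset.sum_const]
  refine Finset.sum_congr rfl fun g _ => ?_
  rw [← Equiv.sum_comp g.symm]
  simp

/-- A set can be moved by a permutation so that it covers as much as possible of another one. -/
lemma exists_perm_card_sdiff_le {α : Type} [Fintype α] [DecidableEq α] (X Y : Finset α) :
    ∃ σ : Equiv.Perm α, (Y \ X.map σ.toEmbedding).card ≤ Y.card - X.card := by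
  rcases le_total X.card Y.card with h | h
  · obtain ⟨Y', hY', hcard⟩ := Finset.exists_subset_card_eq h
    have e : {x // x ∈ X} ≃ {x // x ∈ Y'} := Finset.equivOfCardEq hcard.symm
    refine ⟨e.extendSubtype, ?_⟩
    have hmap : X.map e.extendSubtype.toEmbedding = Y' := by
      refine Finset.eq_of_subset_of_card_le ?_ (by rw [Finset.card_map, hcard])
      intro y hy
      obtain ⟨x, hx, rfl⟩ := Finset.mem_map.1 hy
      exact e.extendSubtype_mem x hx
    rw [hmap, Finset.card_sdiff_of_subset hY', hcard]
  · obtain ⟨X', hX', hcard⟩ := Finset.exists_subset_card_eq h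
    have e : {x // x ∈ X'} ≃ {x // x ∈ Y} := Finset.equivOfCardEq hcard
    refine ⟨e.extendSubtype, ?_⟩
    have hmap : X'.map e.extendSubtype.toEmbedding = Y := by
      refine Finset.eq_of_subset_of_card_le ?_ (by rw [Finset.card_map, hcard])
      intro y hy
      obtain ⟨x, hx, rfl⟩ := Finset.mem_map.1 hy
      exact e.extendSubtype_mem x hx
    have : Y ⊆ X.map e.extendSubtype.toEmbedding := by
      exact hmap.symm.subset.trans (Finset.map_subset_map.2 hX')
    rw [Finset.sdiff_eq_empty_iff_subset.2 this]
    simp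

/-- One transposition corrects a permutation of best coverage: applied before it if `q` is covered,
which leaves the image unchanged; applied after it otherwise, where exchanging `σ p` for `q ∈ Y`
uncovers nothing more. -/
lemma exists_perm_apply_eq_card_sdiff_le {α : Type} [Fintype α] [DecidableEq α] {p q : α}
    {X Y : Finset α} (hp : p ∉ X) (hq : q ∈ Y) :
    ∃ σ : Equiv.Perm α, σ p = q ∧
      (Y \ (insert p X).map σ.toEmbedding).card ≤ Y.card - (X.card + 1) := by
  obtain ⟨σ, hσ⟩ := exists_perm_card_sdiff_le (insert p X) Y
  rw [Finset.card_insert_of_notMem hp] at hσ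
  by_cases hmem : q ∈ (insert p X).map σ.toEmbedding
  · obtain ⟨x, hx, hxq⟩ := Finset.mem_map.1 hmem
    refine ⟨(Equiv.swap p x).trans σ, by simpa using hxq, ?_⟩
    have : (insert p X).map ((Equiv.swap p x).trans σ).toEmbedding =
        (insert p X).map σ.toEmbedding := by
      refine Finset.eq_of_subset_of_card_le ?_ (by simp only [Finset.card_map, le_refl])
      intro y hy
      obtain ⟨z, hz, rfl⟩ := Finset.mem_map.1 hy
      refine Finset.mem_map.2 ⟨Equiv.swap p x z, ?_, rfl⟩
      rcases eq_or_ne z p with rfl | h1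
      · simpa using hx
      · rcases eq_or_ne z x with rfl | h2
        · simp
        · rwa [Equiv.swap_apply_of_ne_of_ne h1 h2]
    rw [this]; exact hσ
  · refine ⟨σ.trans (Equiv.swap (σ p) q), by simp, le_trans ?_ hσ⟩
    by_cases hpY : σ p ∈ Y
    · refine (Finset.card_le_card_of_injOn (Equiv.swap (σ p) q) ?_
        (Equiv.injective _).injOn)
      intro y hy
      simp only [Finset.coe_sdiff, Set.mem_sdiff, Finset.mem_coe, Finset.mem_map_equiv,
        Equiv.symm_trans_apply, Equiv.symm_swap] at hy hmem ⊢
      refine ⟨?_, hy.2⟩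
      rcases eq_or_ne y (σ p) with rfl | h1
      · simpa using hq
      · rcases eq_or_ne y q with rfl | h2
        · simpa using hpY
        · rw [Equiv.swap_apply_of_ne_of_ne h1 h2]; exact hy.1
    · refine Finset.card_le_card ?_
      intro y hy
      simp only [Finset.mem_sdiff, Finset.mem_map_equiv,
        Equiv.symm_trans_apply, Equiv.symm_swap] at hy hmem ⊢
      refine ⟨hy.1, fun hc => hy.2 ?_⟩
      have h1 : y ≠ σ p := fun h => hpY (h ▸ hy.1)
      have h2 : y ≠ q := by
        rintro rfl; exact hmem hc
      rwa [Equiv.swap_apply_of_ne_of_ne h1 h2]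

lemma exists_injOn_of_card_le {α β : Type} [Nonempty β] {E : Finset α} {F : Finset β}
    (h : E.card ≤ F.card) : ∃ f : α → β, Set.InjOn f E ∧ ∀ x ∈ E, f x ∈ F := by
  classical
  obtain ⟨g⟩ : Nonempty (E ↪ F) := Function.Embedding.nonempty_of_card_le (by simpa using h)
  refine ⟨fun x => if hx : x ∈ E then g ⟨x, hx⟩ else Classical.arbitrary β, ?_, ?_⟩
  · intro x hx y hy hxy
    rw [Finset.mem_coe] at hx hy
    simp only [dif_pos hx, dif_pos hy] at hxy
    exact congrArg Subtype.val (g.injective (Subtype.ext hxy))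
  · intro x hx
    simp only [dif_pos hx]
    exact (g ⟨x, hx⟩).2

/-- An injection between finite sets that maps a distinguished subset into another one. -/
lemma exists_injOn_mapsTo_mapsTo {α β : Type} [Nonempty β] (E E' : Finset α) (F F' : Finset β)
    (hE : E' ⊆ E) (hF : F' ⊆ F) (h : E.card ≤ F.card) (h' : E'.card ≤ F'.card) :
    ∃ f : α → β, Set.InjOn f E ∧ (∀ x ∈ E, f x ∈ F) ∧ ∀ x ∈ E', f x ∈ F' := by
  classical
  obtain ⟨g, hginj, hg⟩ := exists_injOn_of_card_le h'
  have himg : E'.image g ⊆ F := fun y hy => by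
    obtain ⟨x, hx, rfl⟩ := Finset.mem_image.1 hy
    exact hF (hg x hx)
  have hcard : (E \ E').card ≤ (F \ E'.image g).card := by
    rw [Finset.card_sdiff_of_subset hE, Finset.card_sdiff_of_subset himg,
      Finset.card_image_of_injOn hginj]
    omega
  obtain ⟨g', hginj', hg'⟩ := exists_injOn_of_card_le hcard
  have hdisj : ∀ x ∈ E', ∀ y ∈ E, y ∉ E' → g x ≠ g' y := fun x hx y hy hy' hxy =>
    (Finset.mem_sdiff.1 (hg' y (Finset.mem_sdiff.2 ⟨hy, hy'⟩))).2
      (hxy ▸ Finset.mem_image_of_mem g hx)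
  refine ⟨fun x => if x ∈ E' then g x else g' x, ?_, ?_, ?_⟩
  · intro x hx y hy hxy
    rw [Finset.mem_coe] at hx hy
    by_cases hx' : x ∈ E' <;> by_cases hy' : y ∈ E' <;> simp only [hx', hy', if_true, if_false] at hxy
    · exact hginj hx' hy' hxy
    · exact absurd hxy (hdisj x hx' y hy hy')
    · exact absurd hxy.symm (hdisj y hy' x hx hx')
    · exact hginj' (by simp [hx, hx']) (by simp [hy, hy']) hxy
  · intro x hx
    by_cases hx' : x ∈ E' <;> simp only [hx', if_true, if_false]
    · exact hF (hg x hx')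
    · exact (Finset.mem_sdiff.1 (hg' x (Finset.mem_sdiff.2 ⟨hx, hx'⟩))).1
  · intro x hx
    simp only [hx, if_true]
    exact hg x hx

end Combinatorics

/-! ### Symmetric schemes for one and for two types of users. -/

section TwoTypes

variable {L : ℕ}

lemma card_filter_fin_lt {K i : ℕ} (hi : i ≤ K) :
    (Finset.univ.filter fun p : Fin K => (p : ℕ) < i).card = i := by
  rw [Fin.card_filter_val_lt, min_eq_right hi]

/-- The scheme of Maddah-Ali and Niesen with `L` antennas: all users cache the same fraction. -/
lemma exists_hasScheme_homogeneous {U : Type} [Fintype U] {t : ℕ}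
    (ht : L + t ≤ Fintype.card U) (hL : 0 < L) :
    ∃ g > 0, ∃ c : U → ℕ, HasScheme U L (g * (L + t)) (g * (Fintype.card U - t)) c ∧
      ∀ k, Fintype.card U * c k = g * ((L + t) * t) := by
  classical
  obtain ⟨s, -, hs⟩ := Finset.exists_subset_card_eq (s := (Finset.univ : Finset U)) (n := L + t)
    (by simpa using ht)
  obtain ⟨τ, -, hτ⟩ := Finset.exists_subset_card_eq (s := (Finset.univ : Finset U)) (n := t)
    (by rw [Finset.card_univ]; omega)
  have : Nonempty U := Fintype.card_pos_iff.1 (by omega)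
  have : NeZero (Fintype.card U - t) := ⟨by omega⟩
  -- As many lacked pieces as places: `(K - t) * (L + t)` on both sides.
  obtain ⟨f, hinj, hmaps⟩ := exists_injOn_of_card_le
    (E := τᶜ ×ˢ (Finset.univ : Finset (Fin (L + t))))
    (F := s ×ˢ (Finset.univ : Finset (Fin (Fintype.card U - t)))) (by
      simp only [Finset.card_product, Finset.card_compl, Finset.card_univ, Fintype.card_fin,
        hs, hτ]
      rw [mul_comm])
  have key := hasScheme_of_orbit (L := L) (MonoidHom.id (Equiv.Perm U))
    (fun _ : Fin (L + t) => τ) (fun _ : Fin (Fintype.card U - t) => s) (fun p a => f (p, a))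
    (fun p a p' a' hp hp' h => Prod.ext_iff.1 (hinj (by simpa using hp) (by simpa using hp') h))
    (fun p a hp => by
      have hmem := (Finset.mem_product.1 (hmaps (p, a) (by simpa using hp))).1
      refine ⟨hmem, ?_⟩
      obtain ⟨σ, h1, h2⟩ := exists_perm_apply_eq_card_sdiff_le hp hmem
      exact ⟨σ, h1, lt_of_le_of_lt h2 (by omega)⟩)
  refine ⟨Fintype.card (Equiv.Perm U), Fintype.card_pos, _, by simpa only [Fintype.card_fin] using key, fun k => ?_⟩
  have := card_mul_card_filter_perm k τ
  rw [hτ] at this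
  simp only [MonoidHom.id_apply, Finset.sum_const, Finset.card_univ, Fintype.card_fin, smul_eq_mul]
  calc _ = (L + t) * (Fintype.card U *
        (Finset.univ.filter fun g : Equiv.Perm U => g k ∈ τ).card) := by ring
    _ = _ := by rw [this]; ring

/-- An assignment of the pieces that the `K` users of one type lack, to the places for this type
in the slots. -/
lemma exists_assignment {A B : Type} [Fintype A] [Fintype B] [Nonempty B] {K : ℕ} (hK : 0 < K)
    {i : A → ℕ} {a : B → ℕ} (hi : ∀ u, i u ≤ K) (ha : ∀ v, a v ≤ K) (pA : A → Bool) (pB : B → Bool)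
    (h : ∑ u, (K - i u) ≤ ∑ v, a v)
    (h' : ∑ u, (if pA u then K - i u else 0) ≤ ∑ v, if pB v then a v else 0) :
    ∃ f : Fin K × A → Fin K × B, Set.InjOn f {x | i x.2 ≤ x.1} ∧
      ∀ x, i x.2 ≤ x.1 → ((f x).1 : ℕ) < a (f x).2 ∧ (pA x.2 = true → pB (f x).2 = true) := by
  classical
  have : NeZero K := ⟨hK.ne'⟩
  have hE : ∀ u, (Finset.univ.filter fun p : Fin K => i u ≤ p).card = K - i u := by
    intro u
    have := Finset.card_filter_add_card_filter_not (s := (Finset.univ : Finset (Fin K)))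
      (fun p => (p : ℕ) < i u)
    simp only [not_lt] at this
    rw [card_filter_fin_lt (hi u), Finset.card_univ, Fintype.card_fin] at this
    omega
  obtain ⟨f, hinj, h1, h2⟩ := exists_injOn_mapsTo_mapsTo
    (Finset.univ.filter fun x : Fin K × A => i x.2 ≤ x.1)
    (Finset.univ.filter fun x : Fin K × A => i x.2 ≤ x.1 ∧ pA x.2 = true)
    (Finset.univ.filter fun x : Fin K × B => (x.1 : ℕ) < a x.2)
    (Finset.univ.filter fun x : Fin K × B => (x.1 : ℕ) < a x.2 ∧ pB x.2 = true)
    (fun x hx => by simp only [Finset.mem_filter] at hx ⊢; exact ⟨hx.1, hx.2.1⟩)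
    (fun x hx => by simp only [Finset.mem_filter] at hx ⊢; exact ⟨hx.1, hx.2.1⟩)
    (by
      simp only [Finset.card_filter, Fintype.sum_prod_type_right]
      simp only [← Finset.card_filter, hE, card_filter_fin_lt (ha _)]
      exact h)
    (by
      simp only [Finset.card_filter, Fintype.sum_prod_type_right]
      refine le_trans (le_of_eq ?_) (h'.trans (le_of_eq ?_))
      · refine Finset.sum_congr rfl fun u _ => ?_
        by_cases hp : pA u = true <;> simp [hp, hE]
      · refine Finset.sum_congr rfl fun v _ => ?_
        by_cases hp : pB v = true <;> simp [hp,
          card_filter_fin_lt (ha _)])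
  refine ⟨f, fun x hx y hy => hinj (by simpa using hx) (by simpa using hy), fun x hx => ⟨?_, ?_⟩⟩
  · simpa using h1 x (by simpa using hx)
  · intro hp
    have := h2 x (by simpa using ⟨hx, hp⟩)
    simp only [Finset.mem_filter] at this
    exact this.2.2

/-- A scheme that is symmetric under permutations of the users of each type. The pieces of class
`u` are cached by `i₁ u` and `i₂ u` users of the two types, and the slots of class `v` serve
`a v` and `b v` users of the two types. -/
lemma exists_hasScheme_twoTypes {K₁ K₂ : ℕ} (hK₁ : 0 < K₁) (hK₂ : 0 < K₂) {A B : Type} [Fintype A]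
    [Fintype B] [Nonempty B] {i₁ i₂ : A → ℕ} {a b : B → ℕ} (hi₁ : ∀ u, i₁ u ≤ K₁)
    (hi₂ : ∀ u, i₂ u ≤ K₂) (ha : ∀ v, a v ≤ K₁) (hb : ∀ v, b v ≤ K₂) (pA : A → Bool) (pB : B → Bool)
    (h₁ : ∑ u, (K₁ - i₁ u) ≤ ∑ v, a v)
    (h₁' : ∑ u, (if pA u then K₁ - i₁ u else 0) ≤ ∑ v, if pB v then a v else 0)
    (h₂ : ∑ u, (K₂ - i₂ u) ≤ ∑ v, b v)
    (h₂' : ∑ u, (if !pA u then K₂ - i₂ u else 0) ≤ ∑ v, if !pB v then b v else 0)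
    (hL₁ : ∀ u v, (pA u = true → pB v = true) → 0 < a v →
      a v - (i₁ u + 1) + (b v - i₂ u) < L)
    (hL₂ : ∀ u v, (pB v = true → pA u = true) → 0 < b v →
      a v - i₁ u + (b v - (i₂ u + 1)) < L) :
    ∃ g > 0, ∃ c : Fin K₁ ⊕ Fin K₂ → ℕ,
      HasScheme (Fin K₁ ⊕ Fin K₂) L (g * Fintype.card A) (g * Fintype.card B) c ∧
      (∀ k, K₁ * c (Sum.inl k) = g * ∑ u, i₁ u) ∧ ∀ k, K₂ * c (Sum.inr k) = g * ∑ u, i₂ u := by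
  classical
  obtain ⟨f₁, hf₁, hm₁⟩ := exists_assignment hK₁ hi₁ ha pA pB h₁ h₁'
  -- Colours are complemented for the second type: unmarked pieces must go to unmarked slots, whence
  -- the reversed implication in `hL₂`.
  obtain ⟨f₂, hf₂, hm₂⟩ := exists_assignment hK₂ hi₂ hb (fun u => !pA u) (fun v => !pB v) h₂ h₂'
  let ini : (K i : ℕ) → Finset (Fin K) := fun K i => Finset.univ.filter fun p => (p : ℕ) < i
  have hini : ∀ {K i : ℕ}, i ≤ K → (ini K i).card = i := fun h => card_filter_fin_lt h
  have hmem : ∀ {K i : ℕ} (p : Fin K), p ∈ ini K i ↔ (p : ℕ) < i := fun p => by simp [ini]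
  let φ := Equiv.Perm.sumCongrHom (Fin K₁) (Fin K₂)
  let τ : A → Finset (Fin K₁ ⊕ Fin K₂) := fun u => (ini K₁ (i₁ u)).disjSum (ini K₂ (i₂ u))
  let s : B → Finset (Fin K₁ ⊕ Fin K₂) := fun v => (ini K₁ (a v)).disjSum (ini K₂ (b v))
  let next : Fin K₁ ⊕ Fin K₂ → A → (Fin K₁ ⊕ Fin K₂) × B := fun p u =>
    Sum.elim (fun p => (Sum.inl (f₁ (p, u)).1, (f₁ (p, u)).2))
      (fun p => (Sum.inr (f₂ (p, u)).1, (f₂ (p, u)).2)) p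
  have key := hasScheme_of_orbit (L := L) φ τ s next
    (by
      rintro (p | p) u (p' | p') u' hp hp' h <;>
        simp only [next, Sum.elim_inl, Sum.elim_inr, Prod.mk.injEq, Sum.inl.injEq, Sum.inr.injEq,
          reduceCtorEq, false_and] at h <;>
        simp only [τ, Finset.inl_mem_disjSum, Finset.inr_mem_disjSum, hmem, not_lt] at hp hp'
      · have := hf₁ (x₁ := (p, u)) (x₂ := (p', u')) hp hp' (Prod.ext h.1 h.2)
        simpa using this
      · have := hf₂ (x₁ := (p, u)) (x₂ := (p', u')) hp hp' (Prod.ext h.1 h.2)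
        simpa using this)
    (by
      rintro (p | p) u hp <;>
        simp only [τ, Finset.inl_mem_disjSum, Finset.inr_mem_disjSum] at hp <;>
        simp only [next, Sum.elim_inl, Sum.elim_inr]
      · obtain ⟨hlt, hcol⟩ := hm₁ (p, u) (by simpa [hmem] using hp)
        set v := (f₁ (p, u)).2
        refine ⟨by simpa [s, hmem] using hlt, ?_⟩
        -- The types are permuted independently, so spare caching users of one type cannot protect
        -- the other; this is why the truncated differences are added separately.
        obtain ⟨σ₁, hσ₁, hc₁⟩ := exists_perm_apply_eq_card_sdiff_le hp ((hmem _).2 hlt)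
        obtain ⟨σ₂, hc₂⟩ := exists_perm_card_sdiff_le (ini K₂ (i₂ u)) (ini K₂ (b v))
        rw [hini (hi₁ u), hini (ha v)] at hc₁
        rw [hini (hi₂ u), hini (hb v)] at hc₂
        refine ⟨(σ₁, σ₂), by simpa [φ] using hσ₁, ?_⟩
        refine lt_of_le_of_lt ?_ (lt_of_le_of_lt (add_le_add hc₁ hc₂)
          (hL₁ u v hcol (by omega)))
        rw [← Finset.card_disjSum]
        refine Finset.card_le_card ?_
        rintro (y | y) hy <;>
          simpa [s, τ, φ, Finset.mem_map_equiv, Equiv.symm_apply_eq] using hy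
      · obtain ⟨hlt, hcol⟩ := hm₂ (p, u) (by simpa [hmem] using hp)
        set v := (f₂ (p, u)).2
        refine ⟨by simpa [s, hmem] using hlt, ?_⟩
        obtain ⟨σ₂, hσ₂, hc₂⟩ := exists_perm_apply_eq_card_sdiff_le hp ((hmem _).2 hlt)
        obtain ⟨σ₁, hc₁⟩ := exists_perm_card_sdiff_le (ini K₁ (i₁ u)) (ini K₁ (a v))
        rw [hini (hi₂ u), hini (hb v)] at hc₂
        rw [hini (hi₁ u), hini (ha v)] at hc₁
        refine ⟨(σ₁, σ₂), by simpa [φ] using hσ₂, ?_⟩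
        refine lt_of_le_of_lt ?_ (lt_of_le_of_lt (add_le_add hc₁ hc₂)
          (hL₂ u v (fun hv => by
            by_contra hu
            simp [hu, hv] at hcol) (by omega)))
        rw [← Finset.card_disjSum]
        refine Finset.card_le_card ?_
        rintro (y | y) hy <;>
          simpa [s, τ, φ, Finset.mem_map_equiv, Equiv.symm_apply_eq] using hy)
  refine ⟨_, Fintype.card_pos, _, key, fun k => ?_, fun k => ?_⟩
  · rw [Finset.mul_sum, Finset.mul_sum]
    refine Finset.sum_congr rfl fun u _ => ?_
    have hfil : (Finset.univ.filter fun g : Equiv.Perm (Fin K₁) × Equiv.Perm (Fin K₂) =>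
        φ g (Sum.inl k) ∈ τ u) =
        (Finset.univ.filter fun g : Equiv.Perm (Fin K₁) => g k ∈ ini K₁ (i₁ u)) ×ˢ
          Finset.univ := by
      ext g; simp [φ, τ]
    have := card_mul_card_filter_perm k (ini K₁ (i₁ u))
    rw [hini (hi₁ u), Fintype.card_fin] at this
    rw [hfil, Finset.card_product, Finset.card_univ, ← mul_assoc, this, Fintype.card_prod]
    ring
  · rw [Finset.mul_sum, Finset.mul_sum]
    refine Finset.sum_congr rfl fun u _ => ?_
    have hfil : (Finset.univ.filter fun g : Equiv.Perm (Fin K₁) × Equiv.Perm (Fin K₂) =>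
        φ g (Sum.inr k) ∈ τ u) = Finset.univ ×ˢ
        (Finset.univ.filter fun g : Equiv.Perm (Fin K₂) => g k ∈ ini K₂ (i₂ u)) := by
      ext g; simp [φ, τ]
    have := card_mul_card_filter_perm k (ini K₂ (i₂ u))
    rw [hini (hi₂ u), Fintype.card_fin] at this
    rw [hfil, Finset.card_product, Finset.card_univ, mul_left_comm, this, Fintype.card_prod]
    ring

end TwoTypes

/-! ### The base schemes for the different regimes. -/

section Cases

variable {t₁ r₁ t₂ r₂ l : ℕ}

/-- Every piece is cached by `t₁` and `t₂` users of the two types, and every slot serves both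
types with full gain. -/
lemma exists_hasScheme_fullGain_of_le (hr₁ : 0 < r₁) (hr₂ : 0 < r₂)
    (h : r₂ * (1 + t₁) ≤ r₁ * (l + t₂))
    (h₁ : r₁ * (l + 1 + (t₁ + t₂)) ≤ (r₁ + r₂) * (t₁ + r₁))
    (h₂ : r₂ * (l + 1 + (t₁ + t₂)) ≤ (r₁ + r₂) * (t₂ + r₂))
    (hle : r₁ * (l + 1 + (t₁ + t₂)) ≤ (t₁ + l) * (r₁ + r₂)) :
    ∃ g > 0, ∃ c : Fin (t₁ + r₁) ⊕ Fin (t₂ + r₂) → ℕ,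
      HasScheme (Fin (t₁ + r₁) ⊕ Fin (t₂ + r₂)) (l + 1) (g * (l + 1 + (t₁ + t₂))) (g * (r₁ + r₂)) c ∧
      (∀ k, (t₁ + r₁) * c (Sum.inl k) = g * ((l + 1 + (t₁ + t₂)) * t₁)) ∧
      ∀ k, (t₂ + r₂) * c (Sum.inr k) = g * ((l + 1 + (t₁ + t₂)) * t₂) := by
  set u := l + 1 + (t₁ + t₂) with hu
  set v := r₁ + r₂ with hv
  have hv0 : 0 < v := by omega
  -- The average number of first-type users per slot is `r₁ * u / v`: `w` slots take the quotient
  -- plus one, the others the quotient.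
  set a := r₁ * u / v with ha
  set w := r₁ * u % v with hw
  have hwv : w < v := Nat.mod_lt _ hv0
  have hdiv : v * a + w = r₁ * u := Nat.div_add_mod _ _
  -- `h` says exactly that the average is at least `t₁ + 1`.
  have ha1 : t₁ + 1 ≤ a := by
    rw [ha, Nat.le_div_iff_mul_le hv0, hu, hv]; linarith
  have hle_a : ∀ n, r₁ * u ≤ n * v → a ≤ n ∧ (0 < w → a + 1 ≤ n) := by
    intro n hn
    constructor
    · by_contra hc
      have : (n + 1) * v ≤ a * v := Nat.mul_le_mul_right _ (by omega)
      linarith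
    · intro hw0
      by_contra hc
      have : n * v ≤ a * v := Nat.mul_le_mul_right _ (by omega)
      linarith
  obtain ⟨ha2, ha2'⟩ := hle_a (t₁ + l) hle
  obtain ⟨ha3, ha3'⟩ := hle_a (t₁ + r₁) (by rw [mul_comm (t₁ + r₁)]; exact h₁)
  -- The other `u - a` places must be filled by distinct users of the second type; this uses `h₂`.
  have ha4 : u ≤ a + (t₂ + r₂) := by
    by_contra hc
    have h5 : (a + (t₂ + r₂) + 1) * v ≤ u * v := Nat.mul_le_mul_right _ (by omega)
    have h6 : u * v = r₁ * u + r₂ * u := by rw [hv]; ring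
    linarith [mul_comm v a, add_mul (a + (t₂ + r₂)) 1 v, add_mul a (t₂ + r₂) v, mul_comm v (t₂ + r₂)]
  have : Nonempty (Fin (v - w) ⊕ Fin w) := ⟨Sum.inl ⟨0, by omega⟩⟩
  have hsplit : (v - w) * a + w * (a + 1) = r₁ * u := by
    rw [← hdiv]
    obtain ⟨x, hx⟩ := Nat.exists_eq_add_of_lt hwv
    rw [show v - w = x + 1 by omega, hx]; ring
  have hsplit' : r₂ * u ≤ (v - w) * (u - a) + w * (u - (a + 1)) := by
    have h3 : (v - w) * (u - a) + (v - w) * a = (v - w) * u := by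
      rw [← mul_add, Nat.sub_add_cancel (by omega)]
    have h4 : w * (u - (a + 1)) + w * (a + 1) = w * u := by
      rw [← mul_add, Nat.sub_add_cancel (by omega)]
    have h5 : (v - w) * u + w * u = r₁ * u + r₂ * u := by
      rw [← add_mul, Nat.sub_add_cancel hwv.le, hv, add_mul]
    omega
  obtain ⟨g, hg, c, hc, hc₁, hc₂⟩ := exists_hasScheme_twoTypes (L := l + 1) (K₁ := t₁ + r₁)
    (K₂ := t₂ + r₂) (by omega) (by omega) (A := Fin u) (B := Fin (v - w) ⊕ Fin w)
    (i₁ := fun _ => t₁) (i₂ := fun _ => t₂) (a := Sum.elim (fun _ => a) (fun _ => a + 1))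
    (b := Sum.elim (fun _ => u - a) (fun _ => u - (a + 1)))
    (by intro; omega) (by intro; omega)
    (by
      rintro (x | x)
      · exact ha3
      · exact ha3' (by have := x.2; omega))
    (by rintro (x | x) <;> simp only [Sum.elim_inl, Sum.elim_inr] <;> omega)
    (fun _ => false) (fun _ => false)
    (by simpa [mul_comm] using hsplit.ge)
    (by simp)
    (by simpa [mul_comm] using hsplit')
    (by simpa [mul_comm] using hsplit')
    (by
      rintro - (x | x) - - <;> simp only [Sum.elim_inl, Sum.elim_inr]
      · omega
      · have := ha2' (by have := x.2; omega)
        omega)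
    (by
      rintro - (x | x) - - <;> simp only [Sum.elim_inl, Sum.elim_inr]
      · omega
      · have := ha2' (by have := x.2; omega)
        omega)
  refine ⟨g, hg, c, ?_, ?_, ?_⟩
  · rw [Fintype.card_sum, Fintype.card_fin, Fintype.card_fin, Fintype.card_fin,
      Nat.sub_add_cancel hwv.le] at hc
    exact hc
  · simpa using hc₁
  · simpa using hc₂

/-- Two classes of pieces, cached by `t₁` and `t₁ + 1` users of the first type. The users of
the first type cache more than the fraction `t₁ / (t₁ + r₁)`, those of the second type less than
`t₂ / (t₂ + r₂)`. -/
lemma exists_hasScheme_twoClasses {n w : ℕ} (hr₁ : 0 < r₁) (hr₂ : 0 < r₂) (ht₂ : 0 < t₂)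
    (hl : 0 < l) (hK₁ : t₁ + l < t₁ + r₁)
    (hw : w = t₁ + r₁ + (t₂ + r₂) + (l + 1))
    (hn : (t₁ + l) * (r₁ + r₂) + n = r₁ * (l + 1 + (t₁ + t₂))) (hnw : n ≤ w) :
    ∃ g > 0, ∃ c : Fin (t₁ + r₁) ⊕ Fin (t₂ + r₂) → ℕ,
      HasScheme (Fin (t₁ + r₁) ⊕ Fin (t₂ + r₂)) (l + 1)
        (g * ((l + 1 + (t₁ + t₂)) * w)) (g * ((r₁ + r₂) * w)) c ∧
      (∀ k, (t₁ + r₁) * c (Sum.inl k) = g * ((l + 1 + (t₁ + t₂)) * (t₁ * w + n))) ∧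
      ∀ k, (t₂ + r₂) * c (Sum.inr k) + g * ((l + 1 + (t₁ + t₂)) * n) =
        g * ((l + 1 + (t₁ + t₂)) * (t₂ * w)) := by
  obtain ⟨s₁, rfl⟩ := Nat.exists_eq_succ_of_ne_zero hr₁.ne'
  obtain ⟨s₂, rfl⟩ := Nat.exists_eq_succ_of_ne_zero ht₂.ne'
  obtain ⟨m, rfl⟩ := Nat.exists_eq_add_of_le hnw
  simp only [Nat.succ_eq_add_one] at *
  set u := l + 1 + (t₁ + (s₂ + 1)) with hu
  set v := s₁ + 1 + r₂ with hv
  have hv0 : 0 < v := by omega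
  have hu0 : 0 < u := by omega
  have hnm : 0 < n + m := by omega
  have e1 : u * (s₁ + 1) = v * (t₁ + l) + n := by rw [mul_comm u, ← hn]; ring
  have e2 : u * r₂ + n = v * (s₂ + 2) := by
    have : u * v = u * (s₁ + 1) + u * r₂ := by rw [hv]; ring
    have : v * u = v * (t₁ + l) + v * (s₂ + 2) := by rw [hu]; ring
    have := mul_comm u v
    omega
  -- The value `w = u + v` is what makes the lacked pieces and the places equal in number for both
  -- types.
  have d1 : u + v = n + m := by omega
  have k1 : t₁ + (s₁ + 1) - t₁ = s₁ + 1 := by omega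
  have k2 : t₁ + (s₁ + 1) - (t₁ + 1) = s₁ := by omega
  have k3 : s₂ + 1 + r₂ - (s₂ + 1) = r₂ := by omega
  have k4 : s₂ + 1 + r₂ - s₂ = r₂ + 1 := by omega
  have : Nonempty (Fin (v * m) ⊕ Fin (v * n)) := by
    rcases Nat.eq_zero_or_pos m with hm | hm
    · exact ⟨Sum.inr ⟨0, Nat.mul_pos hv0 (by omega)⟩⟩
    · exact ⟨Sum.inl ⟨0, Nat.mul_pos hv0 hm⟩⟩
  obtain ⟨g, hg, c, hc, hc₁, hc₂⟩ := exists_hasScheme_twoTypes (L := l + 1) (K₁ := t₁ + (s₁ + 1))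
    (K₂ := s₂ + 1 + r₂) (by omega) (by omega) (A := Fin (u * m) ⊕ Fin (u * n))
    (B := Fin (v * m) ⊕ Fin (v * n))
    (i₁ := Sum.elim (fun _ => t₁) (fun _ => t₁ + 1))
    (i₂ := Sum.elim (fun _ => s₂ + 1) (fun _ => s₂))
    (a := Sum.elim (fun _ => t₁ + l) (fun _ => t₁ + l + 1))
    (b := Sum.elim (fun _ => s₂ + 2) (fun _ => s₂ + 1))
    (by rintro (x | x) <;> simp only [Sum.elim_inl, Sum.elim_inr] <;> omega)
    (by rintro (x | x) <;> simp only [Sum.elim_inl, Sum.elim_inr] <;> omega)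
    (by rintro (x | x) <;> simp only [Sum.elim_inl, Sum.elim_inr] <;> omega)
    (by rintro (x | x) <;> simp only [Sum.elim_inl, Sum.elim_inr] <;> omega)
    -- Slots with only `t₂` users of the second type suit that type only for pieces cached by `t₂ -
    -- 1` of them. The colours exclude the unmarked pieces there and, for the first type, marked
    -- pieces in unmarked slots, which fail when `l = 1`.
    (Sum.elim (fun _ => false) (fun _ => true)) (Sum.elim (fun _ => false) (fun _ => true))
    (by
        simp only [Fintype.sum_sum_type, Sum.elim_inl, Sum.elim_inr, Finset.sum_const, Finset.card_univ,
        Fintype.card_fin, smul_eq_mul, k1, k2]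
        refine le_of_eq (Nat.add_right_cancel (m := u * n) ?_)
        calc _ = (n + m) * (u * (s₁ + 1)) := by ring
          _ = v * m * (t₁ + l) + v * n * (t₁ + l) + (n + m) * n := by rw [e1]; ring
          _ = _ := by rw [← d1]; ring)
    (by
        simp only [Fintype.sum_sum_type, Sum.elim_inl, Sum.elim_inr, Finset.sum_const, Finset.card_univ,
        Fintype.card_fin, smul_eq_mul, k2, if_true, if_false, Bool.false_eq_true, mul_zero,
        zero_add]
        have : u * s₁ ≤ v * (t₁ + l + 1) := by
          have : u * (s₁ + 1) = u * s₁ + u := by ring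
          have : v * (t₁ + l + 1) = v * (t₁ + l) + v := by ring
          omega
        calc u * n * s₁ = n * (u * s₁) := by ring
          _ ≤ n * (v * (t₁ + l + 1)) := Nat.mul_le_mul_left _ this
          _ = _ := by ring)
    (by
        simp only [Fintype.sum_sum_type, Sum.elim_inl, Sum.elim_inr, Finset.sum_const, Finset.card_univ,
        Fintype.card_fin, smul_eq_mul, k3, k4]
        refine le_of_eq (Nat.add_right_cancel (m := v * n) ?_)
        calc _ = (n + m) * (u * r₂) + n * (u + v) := by ring
          _ = (n + m) * (u * r₂ + n) := by rw [d1]; ring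
          _ = _ := by rw [e2]; ring)
    (by
        simp only [Fintype.sum_sum_type, Sum.elim_inl, Sum.elim_inr, Finset.sum_const, Finset.card_univ,
        Fintype.card_fin, smul_eq_mul, k3, if_true, if_false, Bool.not_false, Bool.not_true,
        Bool.false_eq_true, mul_zero, add_zero]
        calc u * m * r₂ = m * (u * r₂) := by ring
          _ ≤ m * (v * (s₂ + 2)) := Nat.mul_le_mul_left _ (by omega)
          _ = _ := by ring)
    (by
      rintro (x | x) (y | y) hp - <;> (simp at hp ⊢; try omega))
    (by
      rintro (x | x) (y | y) hp - <;> (simp at hp ⊢; try omega))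
  refine ⟨g, hg, c, ?_, ?_, ?_⟩
  · simp only [Fintype.card_sum, Fintype.card_fin] at hc
    convert hc using 2 <;> ring
  · intro k
    rw [hc₁]
    simp only [Fintype.sum_sum_type, Sum.elim_inl, Sum.elim_inr, Finset.sum_const,
      Finset.card_univ, Fintype.card_fin, smul_eq_mul]
    ring
  · intro k
    rw [hc₂]
    simp only [Fintype.sum_sum_type, Sum.elim_inl, Sum.elim_inr, Finset.sum_const,
      Finset.card_univ, Fintype.card_fin, smul_eq_mul]
    ring

/-- The users of the second type are the bottleneck. -/
lemma exists_hasScheme_twoPhase {b : ℕ} (hr₁ : 0 < r₁) (hl : 0 < l)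
    (h : r₁ * (l + t₂) ≤ (1 + t₁) * r₂) (hb0 : 0 < b) (hb : b ≤ t₂ + r₂) (hb' : b ≤ l + 1 + t₂)
    (hK₂ : l + t₂ ≤ t₂ + r₂) :
    ∃ g > 0, ∃ c : Fin (t₁ + r₁) ⊕ Fin (t₂ + r₂) → ℕ,
      HasScheme (Fin (t₁ + r₁) ⊕ Fin (t₂ + r₂)) (l + 1) (g * ((1 + t₁) * b))
        (g * (r₁ * b + ((1 + t₁) * r₂ - r₁ * (l + t₂)))) c ∧
      (∀ k, (t₁ + r₁) * c (Sum.inl k) = g * (((1 + t₁) * b) * t₁)) ∧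
      ∀ k, (t₂ + r₂) * c (Sum.inr k) = g * (((1 + t₁) * b) * t₂) := by
  obtain ⟨m, hm⟩ := Nat.exists_eq_add_of_le h
  rw [hm, Nat.add_sub_cancel_left]
  have hmb : (1 + t₁) * b * r₂ = r₁ * b * (l + t₂) + m * b := by
    rw [mul_right_comm, hm]; ring
  have : Nonempty (Fin (r₁ * b) ⊕ Fin m) := ⟨Sum.inl ⟨0, by positivity⟩⟩
  -- The first `r₁ * b` slots exhaust the demands of the first type and leave `l` unprotected users
  -- per piece; the other `m` serve only the second type.
  obtain ⟨g, hg, c, hc, hc₁, hc₂⟩ := exists_hasScheme_twoTypes (L := l + 1) (K₁ := t₁ + r₁)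
    (K₂ := t₂ + r₂) (by omega) (by omega) (A := Fin ((1 + t₁) * b)) (B := Fin (r₁ * b) ⊕ Fin m)
    (i₁ := fun _ => t₁) (i₂ := fun _ => t₂) (a := Sum.elim (fun _ => t₁ + 1) (fun _ => 0))
    (b := Sum.elim (fun _ => l + t₂) (fun _ => b))
    (by intro; omega) (by intro; omega)
    (by rintro (x | x) <;> simp only [Sum.elim_inl, Sum.elim_inr] <;> omega)
    (by rintro (x | x) <;> simp only [Sum.elim_inl, Sum.elim_inr] <;> omega)
    (fun _ => false) (fun _ => false)
    (by simp; linarith)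
    (by simp)
    (by simp; linarith [hmb])
    (by simp; linarith [hmb])
    (by rintro - (x | x) - hx <;> simp only [Sum.elim_inl, Sum.elim_inr] at hx ⊢ <;> omega)
    (by rintro - (x | x) - hx <;> simp only [Sum.elim_inl, Sum.elim_inr] at hx ⊢ <;> omega)
  refine ⟨g, hg, c, ?_, ?_, ?_⟩
  · simpa using hc
  · simpa using hc₁
  · simpa using hc₂

end Cases

/-! ### Memory sharing, and the passage from schemes to delays. -/

section Cases

variable {t₁ r₁ t₂ r₂ l : ℕ}

/-- Full gain. Where one class of pieces does not suffice, two classes are used on one part of the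
files and the homogeneous placement on the other part. -/
lemma exists_hasScheme_fullGain (hr₁ : 0 < r₁) (hr₂ : 0 < r₂) (ht₂ : 0 < t₂) (hl : 0 < l)
    (hγ : t₂ * r₁ < t₁ * r₂) (h : r₂ * (1 + t₁) ≤ r₁ * (l + t₂))
    (h₂ : r₂ * (l + 1 + (t₁ + t₂)) ≤ (r₁ + r₂) * (t₂ + r₂)) :
    ∃ g > 0, ∃ c : Fin (t₁ + r₁) ⊕ Fin (t₂ + r₂) → ℕ,
      HasScheme (Fin (t₁ + r₁) ⊕ Fin (t₂ + r₂)) (l + 1) (g * (l + 1 + (t₁ + t₂))) (g * (r₁ + r₂)) c ∧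
      (∀ k, (t₁ + r₁) * c (Sum.inl k) = g * ((l + 1 + (t₁ + t₂)) * t₁)) ∧
      ∀ k, (t₂ + r₂) * c (Sum.inr k) = g * ((l + 1 + (t₁ + t₂)) * t₂) := by
  -- The first type lacks a smaller fraction of each file, so its average fits whenever that of the
  -- second type does.
  have h₁ : r₁ * (l + 1 + (t₁ + t₂)) ≤ (r₁ + r₂) * (t₁ + r₁) := by
    have h3 : r₁ * (t₂ + r₂) ≤ r₂ * (t₁ + r₁) := by linarith
    refine Nat.le_of_mul_le_mul_right ?_ (show 0 < t₂ + r₂ by omega)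
    calc r₁ * (l + 1 + (t₁ + t₂)) * (t₂ + r₂)
        = r₁ * (t₂ + r₂) * (l + 1 + (t₁ + t₂)) := by ring
      _ ≤ r₂ * (t₁ + r₁) * (l + 1 + (t₁ + t₂)) := Nat.mul_le_mul_right _ h3
      _ = r₂ * (l + 1 + (t₁ + t₂)) * (t₁ + r₁) := by ring
      _ ≤ (r₁ + r₂) * (t₂ + r₂) * (t₁ + r₁) := Nat.mul_le_mul_right _ h₂
      _ = _ := by ring
  rcases le_or_gt (r₁ * (l + 1 + (t₁ + t₂))) ((t₁ + l) * (r₁ + r₂)) with hle | hlt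
  · exact exists_hasScheme_fullGain_of_le hr₁ hr₂ h h₁ h₂ hle
  obtain ⟨n, hn⟩ := Nat.exists_eq_add_of_le hlt.le
  obtain ⟨w, hw⟩ : ∃ w, w = t₁ + r₁ + (t₂ + r₂) + (l + 1) := ⟨_, rfl⟩
  have hn0 : 0 < n := by omega
  have hK₁ : t₁ + l < t₁ + r₁ := by
    refine Nat.lt_of_mul_lt_mul_right (a := r₁ + r₂) ?_
    calc _ < _ := hlt
      _ ≤ _ := h₁
      _ = _ := mul_comm _ _
  -- By `hγ` the average is at most `t₁ + l + 1`, so the excess `n` is at most the number of slots.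
  have hnw : n ≤ w := by
    have : n ≤ r₁ + r₂ := by
      have : r₁ * (l + 1 + (t₁ + t₂)) ≤ (t₁ + l + 1) * (r₁ + r₂) := by nlinarith
      linarith
    omega
  have hKL : l + 1 + (t₁ + t₂) ≤ t₁ + r₁ + (t₂ + r₂) := by
    refine Nat.le_of_mul_le_mul_left ?_ (show 0 < r₁ + r₂ by omega)
    linarith
  obtain ⟨g, hg, c, hc, hc₁, hc₂⟩ := exists_hasScheme_twoClasses hr₁ hr₂ ht₂ hl hK₁ hw hn.symm hnw
  obtain ⟨g', hg', c', hc', hcard⟩ := exists_hasScheme_homogeneous (L := l + 1)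
    (U := Fin (t₁ + r₁) ⊕ Fin (t₂ + r₂)) (t := t₁ + t₂)
    (by simpa only [Fintype.card_sum, Fintype.card_fin] using hKL) (by omega)
  simp only [Fintype.card_sum, Fintype.card_fin] at hc' hcard
  rw [show t₁ + r₁ + (t₂ + r₂) - (t₁ + t₂) = r₁ + r₂ by omega] at hc'
  obtain ⟨m, hm⟩ := Nat.exists_eq_add_of_lt hγ
  -- Here `m + 1 = t₁ * r₂ - t₂ * r₁` measures how far the homogeneous caches of the first type fall
  -- short, and `n` how far the two-class ones overshoot; the weights cancel both deviations.
  have key := (hc'.nsmul (g * n * (t₁ + r₁ + (t₂ + r₂)))).add (hc.nsmul (g' * (m + 1)))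
  have key' : HasScheme (Fin (t₁ + r₁) ⊕ Fin (t₂ + r₂)) (l + 1)
      ((g * n * (t₁ + r₁ + (t₂ + r₂)) * g' + g' * (m + 1) * (g * w)) * (l + 1 + (t₁ + t₂)))
      ((g * n * (t₁ + r₁ + (t₂ + r₂)) * g' + g' * (m + 1) * (g * w)) * (r₁ + r₂))
      ((g * n * (t₁ + r₁ + (t₂ + r₂))) • c' + (g' * (m + 1)) • c) := by
    convert key using 1 <;> ring
  refine ⟨g * n * (t₁ + r₁ + (t₂ + r₂)) * g' + g' * (m + 1) * (g * w), by positivity,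
    _, key', fun k => ?_, fun k => ?_⟩
  · have e1 := hcard (Sum.inl k)
    have e2 := hc₁ k
    simp only [Pi.add_apply, Pi.smul_apply, smul_eq_mul]
    zify at e1 e2 hm ⊢
    linear_combination (t₁ + r₁ : ℤ) * g * n * e1 + (g' * (m + 1) : ℤ) * e2 -
      (g * g' * n * (l + 1 + (t₁ + t₂)) : ℤ) * hm
  · have e1 := hcard (Sum.inr k)
    have e2 := hc₂ k
    simp only [Pi.add_apply, Pi.smul_apply, smul_eq_mul]
    zify at e1 e2 hm ⊢
    linear_combination (t₂ + r₂ : ℤ) * g * n * e1 + (g' * (m + 1) : ℤ) * e2 +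
      (g * g' * n * (l + 1 + (t₁ + t₂)) : ℤ) * hm

lemma achievableDelay_twoTypes {L K₁ K₂ N t₁ t₂ u v g : ℕ} {γ₁ γ₂ : ℝ} (hK₁ : 0 < K₁) (hK₂ : 0 < K₂)
    (ht₁ : K₁ * γ₁ = t₁) (ht₂ : K₂ * γ₂ = t₂) (hu : 0 < u) (hv : 0 < v) (hg : 0 < g)
    {c : Fin K₁ ⊕ Fin K₂ → ℕ} (hc : HasScheme (Fin K₁ ⊕ Fin K₂) L (g * u) (g * v) c)
    (hc₁ : ∀ k, K₁ * c (Sum.inl k) = g * (u * t₁))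
    (hc₂ : ∀ k, K₂ * c (Sum.inr k) = g * (u * t₂)) :
    AchievableDelay (twoTypes K₁ γ₁ K₂ γ₂) L N (v / u) := by
  have hu' : (0 : ℝ) < u := by exact_mod_cast hu
  have hv' : (0 : ℝ) < v := by exact_mod_cast hv
  have hK₁' : (0 : ℝ) < K₁ := by exact_mod_cast hK₁
  have hK₂' : (0 : ℝ) < K₂ := by exact_mod_cast hK₂
  refine hc.achievableDelay (Nat.mul_pos hg hu) ?_ (le_of_eq ?_) (by positivity)
  · rintro (k | k)
    · refine le_of_mul_le_mul_left (le_of_eq ?_) hK₁'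
      have : (K₁ : ℝ) * c (Sum.inl k) = g * (u * t₁) := by exact_mod_cast hc₁ k
      simp only [twoTypes, Sum.elim_inl]
      rw [this, ← ht₁]
      push_cast
      ring
    · refine le_of_mul_le_mul_left (le_of_eq ?_) hK₂'
      have : (K₂ : ℝ) * c (Sum.inr k) = g * (u * t₂) := by exact_mod_cast hc₂ k
      simp only [twoTypes, Sum.elim_inr]
      rw [this, ← ht₂]
      push_cast
      ring
  · push_cast
    field_simp

end Cases

end MisoBC

/-! ### The theorem, reduced to inequalities between natural numbers. -/

theorem theorem4 (L K₁ K₂ N t₁ t₂ : ℕ) (γ₁ γ₂ : ℝ)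
    (hL : 2 ≤ L) (hK₁ : 0 < K₁) (hK₂ : 0 < K₂) (hN : K₁ + K₂ ≤ N)
    (hγ₂ : 0 < γ₂) (hγ : γ₂ < γ₁) (hγ₁ : γ₁ < 1)
    (ht₁ : K₁ * γ₁ = t₁) (ht₂ : K₂ * γ₂ = t₂) :
    (K₂ * (1 - γ₂) / (L - 1 + K₂ * γ₂) ≤ MisoBC.singleDelay K₁ γ₁ →
        MisoBC.fullGainDelay L K₁ γ₁ K₂ γ₂ =
            MisoBC.homogeneousDelay L (K₁ + K₂) ((K₁ * γ₁ + K₂ * γ₂) / (K₁ + K₂)) ∧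
          (1 - γ₂ ≤ MisoBC.fullGainDelay L K₁ γ₁ K₂ γ₂ →
            MisoBC.AchievableDelay (MisoBC.twoTypes K₁ γ₁ K₂ γ₂) L N
              (MisoBC.fullGainDelay L K₁ γ₁ K₂ γ₂))) ∧
      (MisoBC.singleDelay K₁ γ₁ < K₂ * (1 - γ₂) / (L - 1 + K₂ * γ₂) →
        1 - γ₂ ≤ MisoBC.twoPhaseDelay L K₁ γ₁ K₂ γ₂ →
          MisoBC.AchievableDelay (MisoBC.twoTypes K₁ γ₁ K₂ γ₂) L N
            (MisoBC.twoPhaseDelay L K₁ γ₁ K₂ γ₂)) := by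
  have hK₁' : (0 : ℝ) < K₁ := by exact_mod_cast hK₁
  have hK₂' : (0 : ℝ) < K₂ := by exact_mod_cast hK₂
  have hlt₁ : t₁ < K₁ := by
    have : (t₁ : ℝ) < K₁ := by rw [← ht₁]; nlinarith
    exact_mod_cast this
  have hlt₂ : t₂ < K₂ := by
    have : (t₂ : ℝ) < K₂ := by rw [← ht₂]; nlinarith
    exact_mod_cast this
  have htp₂ : 0 < t₂ := by
    have : (0 : ℝ) < t₂ := by rw [← ht₂]; positivity
    exact_mod_cast this
  -- `r₁` and `r₂` count the users of each type that lack a piece cached by `t₁` and `t₂` of them.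
  obtain ⟨r₁, rfl⟩ := Nat.exists_eq_add_of_le hlt₁.le
  obtain ⟨r₂, rfl⟩ := Nat.exists_eq_add_of_le hlt₂.le
  obtain ⟨l, rfl⟩ := Nat.exists_eq_add_of_le' (show 1 ≤ L by omega)
  have hr₁ : 0 < r₁ := by omega
  have hr₂ : 0 < r₂ := by omega
  have hl : 0 < l := by omega
  have hr₁' : (0 : ℝ) < r₁ := by exact_mod_cast hr₁
  have hr₂' : (0 : ℝ) < r₂ := by exact_mod_cast hr₂
  have e₁ : ((t₁ + r₁ : ℕ) : ℝ) * (1 - γ₁) = r₁ := by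
    rw [mul_sub, ht₁]; push_cast; ring
  have e₂ : ((t₂ + r₂ : ℕ) : ℝ) * (1 - γ₂) = r₂ := by
    rw [mul_sub, ht₂]; push_cast; ring
  have eγ₂ : 1 - γ₂ = r₂ / (t₂ + r₂ : ℕ) := by rw [eq_div_iff hK₂'.ne', mul_comm, e₂]
  have hcross : t₂ * r₁ < t₁ * r₂ := by
    have h1 : (t₂ : ℝ) * (t₁ + r₁ : ℕ) < t₁ * (t₂ + r₂ : ℕ) := by
      rw [← ht₁, ← ht₂]
      nlinarith [mul_pos hK₁' hK₂']
    have h2 : t₂ * (t₁ + r₁) < t₁ * (t₂ + r₂) := by exact_mod_cast h1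
    linarith
  have hfull : MisoBC.fullGainDelay (l + 1) (t₁ + r₁) γ₁ (t₂ + r₂) γ₂ =
      ((r₁ + r₂ : ℕ) : ℝ) / ((l + 1 + (t₁ + t₂) : ℕ) : ℝ) := by
    rw [MisoBC.fullGainDelay, e₁, e₂, ht₁, ht₂]
    push_cast
    rw [add_assoc ((l : ℝ) + 1)]
  have hsingle : MisoBC.singleDelay (t₁ + r₁) γ₁ = (r₁ : ℝ) / (1 + t₁) := by
    rw [MisoBC.singleDelay, e₁, ht₁]
  have hbound : ((t₂ + r₂ : ℕ) : ℝ) * (1 - γ₂) / (((l + 1 : ℕ) : ℝ) - 1 + (t₂ + r₂ : ℕ) * γ₂) =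
      (r₂ : ℝ) / (l + t₂) := by
    rw [e₂, ht₂]
    push_cast
    rw [add_sub_cancel_right]
  rw [hbound, hsingle]
  refine ⟨fun h => ⟨?_, fun hT => ?_⟩, fun h hT => ?_⟩
  · have hK : (0 : ℝ) < (t₁ + r₁ : ℕ) + (t₂ + r₂ : ℕ) := by positivity
    rw [MisoBC.fullGainDelay, MisoBC.homogeneousDelay]
    have e3 : (((t₁ + r₁) + (t₂ + r₂) : ℕ) : ℝ) *
        (((t₁ + r₁ : ℕ) * γ₁ + (t₂ + r₂ : ℕ) * γ₂) / ((t₁ + r₁ : ℕ) + (t₂ + r₂ : ℕ))) =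
        (t₁ + r₁ : ℕ) * γ₁ + (t₂ + r₂ : ℕ) * γ₂ := by
      rw [Nat.cast_add (t₁ + r₁), mul_div_cancel₀ _ hK.ne']
    have e4 : (((t₁ + r₁) + (t₂ + r₂) : ℕ) : ℝ) *
        (1 - ((t₁ + r₁ : ℕ) * γ₁ + (t₂ + r₂ : ℕ) * γ₂) / ((t₁ + r₁ : ℕ) + (t₂ + r₂ : ℕ))) =
        (t₁ + r₁ : ℕ) * (1 - γ₁) + (t₂ + r₂ : ℕ) * (1 - γ₂) := by
      rw [mul_sub, e3, Nat.cast_add (t₁ + r₁)]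
      ring
    rw [e4, e3, add_assoc]
  · rw [hfull] at hT ⊢
    -- Cleared of denominators, `1 - γ₂ ≤ T` bounds the average number of second-type users per slot
    -- by their total number.
    rw [eγ₂, div_le_div_iff₀ hK₂' (by positivity)] at hT
    rw [div_le_div_iff₀ (by positivity) (by positivity)] at h
    obtain ⟨g, hg, c, hc, hc₁, hc₂⟩ := MisoBC.exists_hasScheme_fullGain hr₁ hr₂ htp₂ hl hcross
      (by exact_mod_cast h) (by exact_mod_cast hT)
    exact MisoBC.achievableDelay_twoTypes hK₁ hK₂ ht₁ ht₂ (by omega) (by omega) hg hc hc₁ hc₂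
  · rw [div_lt_div_iff₀ (by positivity) (by positivity)] at h
    have h' : r₁ * (l + t₂) < r₂ * (1 + t₁) := by exact_mod_cast h
    set b := min (t₂ + r₂) (l + 1 + t₂) with hb
    have hb0 : 0 < b := by omega
    have hb0' : (0 : ℝ) < b := by exact_mod_cast hb0
    have hmin : min ((t₂ + r₂ : ℕ) : ℝ) (((l + 1 : ℕ) : ℝ) + (t₂ + r₂ : ℕ) * γ₂) = b := by
      rw [ht₂, hb]; push_cast; rfl
    have htwo : MisoBC.twoPhaseDelay (l + 1) (t₁ + r₁) γ₁ (t₂ + r₂) γ₂ =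
        ((r₁ * b + ((1 + t₁) * r₂ - r₁ * (l + t₂)) : ℕ) : ℝ) / (((1 + t₁) * b : ℕ) : ℝ) := by
      rw [MisoBC.twoPhaseDelay, hmin, hsingle, e₂, ht₂, Nat.cast_add (r₁ * b),
        Nat.cast_sub (by linarith)]
      push_cast
      have : (1 : ℝ) + t₁ ≠ 0 := by positivity
      field_simp
      ring
    -- The first-phase slots need `l + t₂` users of the second type. With fewer of them `b = K₂`,
    -- and the delay would drop below `1 - γ₂`.
    have hcap : l + t₂ ≤ t₂ + r₂ := by
      by_contra hc
      have hbK : b = t₂ + r₂ := by omega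
      rw [htwo, eγ₂, hbK, div_le_div_iff₀ (by positivity) (by positivity)] at hT
      have hT' : r₂ * ((1 + t₁) * (t₂ + r₂)) ≤
        (r₁ * (t₂ + r₂) + ((1 + t₁) * r₂ - r₁ * (l + t₂))) * (t₂ + r₂) := by exact_mod_cast hT
      rw [← mul_assoc] at hT'
      have h1 := Nat.le_of_mul_le_mul_right hT' (by omega)
      have h2 : r₁ * (t₂ + r₂) < r₁ * (l + t₂) := Nat.mul_lt_mul_of_pos_left (by omega) hr₁
      have h3 := mul_comm r₂ (1 + t₁)
      omega
    rw [htwo]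
    obtain ⟨g, hg, c, hc, hc₁, hc₂⟩ := MisoBC.exists_hasScheme_twoPhase (t₁ := t₁) (t₂ := t₂) hr₁ hl
      (by linarith : r₁ * (l + t₂) ≤ (1 + t₁) * r₂) hb0 (by omega : b ≤ t₂ + r₂) (by omega) hcap
    exact MisoBC.achievableDelay_twoTypes hK₁ hK₂ ht₁ ht₂ (by positivity) (by positivity) hg hc
      hc₁ hc₂
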